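/- Let $n\ge 2$ and let all vector spaces be over a field $K$. **Data.** An $n$-Lie algebra is a vector space $\mathfrak g$ with an alternating $n$-linear bracket such that $[x_1,\dots,x_{n-1},[y_1,\dots,y_n]]=\sum_{i=1}^n[y_1,\dots,[x_1,\dots,x_{n-1},y_i],\dots,y_n]$. A representation of $\mathfrak g$ on $V$ is an alternating map $\rho:\wedge^{n-1}\mathfrak g\to\mathfrak{gl}(V)$ with $[\rho(x_1,\dots,x_{n-1}),\rho(y_1,\dots,y_{n-1})]=\sum_{i=1}^{n-1}\rho(y_1,\dots,[x_1,\dots,x_{n-1},y_i],\dots,y_{n-1})$ and $\rho(x_1,\dots,x_{n-2},[y_1,\dots,y_n])=\sum_{i=1}^n(-1)^{n-i}\rho(y_1,\dots,\widehat{y_i},\dots,y_n)\,\rho(x_1,\dots,x_{n-2},y_i)$. An $n$-Lie algebra $(M,\mathfrak g,f)$ in the category $\mathcal{LM}$ of linear maps consists of an $n$-Lie algebra $\mathfrak g$, a representation $(M,\rho)$ of it and a linear map $f:M\to\mathfrak g$ with $f(\rho(x_1,\dots,x_{n-1})m)=[x_1,\dots,x_{n-1},f(m)]$. A representation $(V,W,\varphi)$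 of $(M,\mathfrak g,f)$ consists of representations $(V,\rho_1)$, $(W,\rho_2)$ of $\mathfrak g$, a linear map $\varphi:V\to W$ with $\varphi\rho_1(x)=\rho_2(x)\varphi$, and a multilinear map $\rho_3:\mathfrak g^{n-2}\times M\to\mathrm{Hom}(W,V)$, alternating in its $n-2$ arguments from $\mathfrak g$, such that, for $x,y$ tuples in $\mathfrak g$ of the lengths shown, $m\in M$, $w\in W$: * $\varphi\rho_3(x_1,\dots,x_{n-2},m)w=\rho_2(x_1,\dots,x_{n-2},f(m))w$; * $\rho_1(x_1,\dots,x_{n-1})\rho_3(y_1,\dots,y_{n-2},m)w=\rho_3(y_1,\dots,y_{n-2},\rho(x_1,\dots,x_{n-1})m)w+\rho_3(y_1,\dots,y_{n-2},m)\rho_2(x_1,\dots,x_{n-1})w+\sum_{i=1}^{n-2}\rho_3(y_1,\dots,[x_1,\dots,x_{n-1},y_i],\dots,y_{n-2},m)w$; * $\rho_3(x_1,\dots,x_{n-2},\rho(y_1,\dots,y_{n-1})m)w=\rho_1(y_1,\dots,y_{n-1})\rho_3(x_1,\dots,x_{n-2},m)w+\sum_{i=1}^{n-1}(-1)^{n-i}\rho_3(y_1,\dots,\widehat{y_i},\dots,y_{n-1},m)\rho_2(x_1,\dots,x_{n-2},y_i)w$;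 * if $n\ge3$: $\rho_3(x_1,\dots,x_{n-3},[y_1,\dots,y_n],m)w=\sum_{i=1}^n(-1)^{n-i}\rho_1(y_1,\dots,\widehat{y_i},\dots,y_n)\rho_3(x_1,\dots,x_{n-3},y_i,m)w$; * $\rho_3(x_1,\dots,x_{n-2},m)\rho_2(y_1,\dots,y_{n-1})w=\rho_1(y_1,\dots,y_{n-1})\rho_3(x_1,\dots,x_{n-2},m)w+\sum_{i=1}^{n-1}(-1)^{n-i}\rho_3(y_1,\dots,\widehat{y_i},\dots,y_{n-1},\rho(x_1,\dots,x_{n-2},y_i)m)w$. **Cochains.** Put $L=\wedge^{n-1}\mathfrak g$, acting on $\mathfrak g$ by $[X,z]=[x_1,\dots,x_{n-1},z]$ for $X=x_1\wedge\dots\wedge x_{n-1}$, with $X\circ(y_1\wedge\dots\wedge y_{n-1})=\sum_i y_1\wedge\dots\wedge[X,y_i]\wedge\dots\wedge y_{n-1}$; write $\rho(X)=\rho(x_1,\dots,x_{n-1})$, and likewise $\rho_1(X),\rho_2(X)$. For $k\ge0$ let $$C^k=\mathrm{Hom}(L^{\otimes k},\mathrm{Hom}(\mathfrak g,W))\oplus\mathrm{Hom}(L^{\otimes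 k},\mathrm{Hom}(M,V))\oplus\mathrm{Hom}(L^{\otimes(k-1)},\mathrm{Hom}(M,W)),$$ the last summand being $0$ for $k=0$. It contains the subspace $C^k_{\mathrm{alt}}=\mathrm{Hom}(\wedge^{k(n-1)+1}\mathfrak g,W)\oplus\mathrm{Hom}(\wedge^{k(n-1)}\mathfrak g,\mathrm{Hom}(M,V))\oplus\mathrm{Hom}(\wedge^{(k-1)(n-1)}\mathfrak g,\mathrm{Hom}(M,W))$ of totally skew-symmetric cochains, and the subspace $C^k_{\mathrm{sk}}$ of those $(\omega,\nu,\theta)$ whose $\omega(X_1,\dots,X_{k-1},x_1\wedge\dots\wedge x_{n-1})(x_n)$ is alternating in $x_1,\dots,x_n$ (no condition for $k=0$). For a space $E$ with a left action $[X,e]_L$ and a right action $[e,X]_R$ of $L$ and $\alpha\in\mathrm{Hom}(L^{\otimes(q-1)},E)$ let $$d\alpha(X_1,\dots,X_q)=\sum_{i=1}^{q-1}(-1)^{i+1}[X_i,\alpha(\dots,\widehat{X_i},\dots)]_L+(-1)^q[\alpha(X_1,\dots,X_{q-1}),X_q]_R+\sum_{1\le i<j\le q}(-1)^i\alpha(\dots,\widehat{X_i},\dots,X_i\circ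 X_j,\dots),$$ where $X_i\circ X_j$ stands in the place of $X_j$. Let $\delta_1,\delta_2,\delta_3$ be this operator for $E=\mathrm{Hom}(\mathfrak g,W),\mathrm{Hom}(M,V),\mathrm{Hom}(M,W)$, respectively (with $\delta_3=0$ on the zero summand of $C^0$). The actions on $\mathrm{Hom}(\mathfrak g,W)$ are $[X,\phi]_L(z)=\rho_2(X)\phi(z)-\phi([X,z])$ and $[\phi,x_1\wedge\dots\wedge x_{n-1}]_R(x_n)=\phi([x_1,\dots,x_n])-\sum_{i=1}^n(-1)^{n-i}\rho_2(x_1,\dots,\widehat{x_i},\dots,x_n)\phi(x_i)$; on $\mathrm{Hom}(M,V)$ and $\mathrm{Hom}(M,W)$ they are $[X,\nu]_L=-[\nu,X]_R=\rho_j(X)\nu-\nu\rho(X)$ with $j=1$ and $j=2$, respectively. Define $$h_1(\omega)(X_1,\dots,X_k,x_1\wedge\dots\wedge x_{n-1})(m)=-\sum_{i=1}^{n-1}(-1)^{n-i}\rho_3(x_1,\dots,\widehat{x_i},\dots,x_{n-1},m)\,\omega(X_1,\dots,X_k)(x_i),$$ $$h_2(\omega)(X_1,\dots,X_k)(m)=(-1)^k\omega(X_1,\dots,X_k)(f(m)),\qquad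 \varphi_\sharp(\nu)(X_1,\dots,X_k)(m)=\varphi(\nu(X_1,\dots,X_k)(m)),$$ $$D_k:C^k\to C^{k+1},\qquad D_k(\omega,\nu,\theta)=(-\delta_1\omega,\;-h_1\omega+\delta_2\nu,\;-h_2\omega+\varphi_\sharp\nu-\delta_3\theta).$$ **Claim.** $D_{k+1}D_k=0$ for all $k\ge0$. Hence, with $Z^k=\ker D_k$, $B^k=\operatorname{im}D_{k-1}$ for $k\ge1$ and $B^0=0$, one has $B^k\subseteq Z^k$, and the cohomology groups $H^k((M,\mathfrak g,f),(V,W,\varphi))=Z^k/B^k$ are defined. Moreover $D_k(C^k_{\mathrm{sk}})\subseteq C^{k+1}_{\mathrm{sk}}$ for all $k\ge0$, and for $n=2$ also $D_k(C^k_{\mathrm{alt}})\subseteq C^{k+1}_{\mathrm{alt}}$ for all $k\ge0$. -/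

import Mathlib

/-!
# `n`-Lie algebras in the Loday-Pirashvili category and their cochain maps

The arity is `n = d + 2` with `d : ℕ`, so that `n ≥ 2`, `n - 1 = d + 1` and `n - 2 = d`.
Indices are zero-based: the one-based sign `(-1) ^ (n - i)` is `(-1) ^ (d + 1 - i)` here, which is
written `(-1) ^ (d + 1 + i)`.
-/

noncomputable section

namespace NLie

/-- An `n`-Lie algebra structure on the vector space `g`, with `n = d + 2`: a totally
skew-symmetric `n`-linear bracket that satisfies the fundamental identity
`[x₁, …, xₙ₋₁, [y₁, …, yₙ]] = ∑ᵢ [y₁, …, [x₁, …, xₙ₋₁, yᵢ], …, yₙ]`. -/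
structure NLieAlgebra (d : ℕ) (K g : Type*) [Field K] [AddCommGroup g] [Module K g] where
  bracket : g [⋀^Fin (d + 2)]→ₗ[K] g
  fundamental : ∀ (x : Fin (d + 1) → g) (y : Fin (d + 2) → g),
    bracket (Fin.snoc x (bracket y)) =
      ∑ i, bracket (Function.update y i (bracket (Fin.snoc x (y i))))

/-- A representation of an `n`-Lie algebra on the vector space `V`. -/
structure Representation {d : ℕ} {K g : Type*} [Field K] [AddCommGroup g] [Module K g]
    (A : NLieAlgebra d K g) (V : Type*) [AddCommGroup V] [Module K V] where
  act : g [⋀^Fin (d + 1)]→ₗ[K] (V →ₗ[K] V)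
  /-- `[ρ(x), ρ(y)] = ρ(x ∘ y)`. -/
  act_comm : ∀ (x y : Fin (d + 1) → g),
    act x ∘ₗ act y - act y ∘ₗ act x =
      ∑ i, act (Function.update y i (A.bracket (Fin.snoc x (y i))))
  /-- `ρ(x₁, …, xₙ₋₂, [y₁, …, yₙ]) = ∑ᵢ (-1)ⁿ⁻ⁱ ρ(y₁, …, ŷᵢ, …, yₙ) ρ(x₁, …, xₙ₋₂, yᵢ)`. -/
  act_bracket : ∀ (x : Fin d → g) (y : Fin (d + 2) → g),
    act (Fin.snoc x (A.bracket y)) =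
      ∑ i : Fin (d + 2), (-1 : K) ^ (d + 1 + (i : ℕ)) •
        (act (i.removeNth y) ∘ₗ act (Fin.snoc x (y i)))

/-- An `n`-Lie algebra `(M, g, f)` in the category of linear maps: an `n`-Lie algebra `g`, a
representation `M` of it, and an equivariant linear map `f : M → g`. -/
structure NLieLM (d : ℕ) (K M g : Type*) [Field K] [AddCommGroup M] [Module K M]
    [AddCommGroup g] [Module K g] where
  alg : NLieAlgebra d K g
  rep : Representation alg M
  f : M →ₗ[K] g
  equivariant : ∀ (x : Fin (d + 1) → g) (m : M),
    f (rep.act x m) = alg.bracket (Fin.snoc x (f m))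

/-- A representation `(V, W, φ)`, `ρ = (ρ₁, ρ₂, ρ₃)`, of an `n`-Lie algebra `(M, g, f)` in the
category of linear maps. The map `ρ₃` is skew-symmetric in its `n - 2` arguments from `g`. -/
structure LMRepresentation {d : ℕ} {K M g : Type*} [Field K] [AddCommGroup M] [Module K M]
    [AddCommGroup g] [Module K g] (A : NLieLM d K M g)
    (V W : Type*) [AddCommGroup V] [Module K V] [AddCommGroup W] [Module K W] where
  rho₁ : Representation A.alg V
  rho₂ : Representation A.alg W
  φ : V →ₗ[K] W
  φ_equivariant : ∀ (x : Fin (d + 1) → g) (v : V),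
    φ (rho₁.act x v) = rho₂.act x (φ v)
  rho₃ : g [⋀^Fin d]→ₗ[K] (M →ₗ[K] W →ₗ[K] V)
  φ_rho₃ : ∀ (x : Fin d → g) (m : M) (w : W),
    φ (rho₃ x m w) = rho₂.act (Fin.snoc x (A.f m)) w
  rho₁_rho₃ : ∀ (x : Fin (d + 1) → g) (y : Fin d → g) (m : M) (w : W),
    rho₁.act x (rho₃ y m w) =
      rho₃ y (A.rep.act x m) w + rho₃ y m (rho₂.act x w) +
        ∑ i : Fin d, rho₃ (Function.update y i (A.alg.bracket (Fin.snoc x (y i)))) m w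
  rho₃_rep : ∀ (x : Fin d → g) (y : Fin (d + 1) → g) (m : M) (w : W),
    rho₃ x (A.rep.act y m) w =
      rho₁.act y (rho₃ x m w) +
        ∑ i : Fin (d + 1), (-1 : K) ^ (d + 1 + (i : ℕ)) •
          rho₃ (i.removeNth y) m (rho₂.act (Fin.snoc x (y i)) w)
  /-- Since `ρ₃` is skew-symmetric, it does not matter which of its `n - 2` arguments from `g`
  the bracket is put into; for `n = 2` there is none, and the condition is void. -/
  rho₃_bracket : ∀ (x : Fin d → g) (k : Fin d) (y : Fin (d + 2) → g) (m : M) (w : W),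
    rho₃ (Function.update x k (A.alg.bracket y)) m w =
      ∑ i : Fin (d + 2), (-1 : K) ^ (d + 1 + (i : ℕ)) •
        rho₁.act (i.removeNth y) (rho₃ (Function.update x k (y i)) m w)
  rho₃_rho₂ : ∀ (x : Fin d → g) (y : Fin (d + 1) → g) (m : M) (w : W),
    rho₃ x m (rho₂.act y w) =
      rho₁.act y (rho₃ x m w) +
        ∑ i : Fin (d + 1), (-1 : K) ^ (d + 1 + (i : ℕ)) •
          rho₃ (i.removeNth y) (A.rep.act (Fin.snoc x (y i)) m) w

/-! ### Multilinear preliminaries -/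

section Multilinear

variable {K g N : Type*} [Field K] [AddCommGroup g] [Module K g] [AddCommGroup N] [Module K N]

/-- An alternating map in `m + 1` arguments as an alternating map in the first `m` arguments with
values in the linear maps in the last one: `x ↦ (z ↦ F (x₁, …, xₘ, z))`. -/
def curryLast (m : ℕ) :
    (g [⋀^Fin (m + 1)]→ₗ[K] N) →ₗ[K] (g [⋀^Fin m]→ₗ[K] (g →ₗ[K] N)) where
  toFun F :=
    { toFun := fun x =>
        { toFun := fun z => F (Fin.snoc x z)
          map_add' := fun z z' => by
            have h := F.map_update_add (Fin.snoc x 0 : Fin (m + 1) → g) (Fin.last m) z z'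
            simpa only [Fin.update_snoc_last] using h
          map_smul' := fun c z => by
            have h := F.map_update_smul (Fin.snoc x 0 : Fin (m + 1) → g) (Fin.last m) c z
            rw [RingHom.id_apply]
            simpa only [Fin.update_snoc_last] using h }
      map_update_add' := fun {inst} x i a b => by
        obtain rfl := Subsingleton.elim inst (instDecidableEqFin m)
        ext z
        simp [Fin.snoc_update]
      map_update_smul' := fun {inst} x i c a => by
        obtain rfl := Subsingleton.elim inst (instDecidableEqFin m)
        ext z
        simp [Fin.snoc_update]
      map_eq_zero_of_eq' := fun x i j hij hne => by
        ext z
        refine F.map_eq_zero_of_eq (Fin.snoc x z) (i := i.castSucc) (j := j.castSucc) ?_ ?_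
        · simpa using hij
        · simpa using hne }
  map_add' F G := by ext; simp
  map_smul' c F := by ext; simp

@[simp] theorem curryLast_apply (m : ℕ) (F : g [⋀^Fin (m + 1)]→ₗ[K] N) (x : Fin m → g) (z : g) :
    curryLast m F x z = F (Fin.snoc x z) := rfl

/-- The alternating map `(y₁, …, yₘ) ↦ ∑ᵢ y₁ ∧ … ∧ T yᵢ ∧ … ∧ yₘ`. -/
def derivationAlt (m : ℕ) (T : g →ₗ[K] g) : g [⋀^Fin m]→ₗ[K] (⋀[K]^m g) where
  toMultilinearMap := ∑ i : Fin m, (exteriorPower.ιMulti K m).toMultilinearMap.compLinearMap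
    (fun j => if j = i then T else LinearMap.id)
  map_eq_zero_of_eq' y i j hij hne := by
    have key : ∀ k : Fin m, (fun l => (if l = k then T else LinearMap.id) (y l)) =
        Function.update y k (T (y k)) := by
      intro k
      funext l
      by_cases h : l = k
      · subst h; simp
      · simp [h]
    simp only [MultilinearMap.toFun_eq_coe, sum_apply,
      MultilinearMap.compLinearMap_apply, key, AlternatingMap.coe_multilinearMap]
    rw [← Finset.sum_subset (Finset.subset_univ {i, j}), Finset.sum_pair hne]
    · have hs : Function.update y j (T (y j)) =
          Function.update y i (T (y i)) ∘ Equiv.swap i j := by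
        funext l
        rcases eq_or_ne l i with rfl | hi
        · simp [Function.update_of_ne hne, Function.update_of_ne hne.symm, hij]
        · rcases eq_or_ne l j with rfl | hj
          · simp [hij]
          · simp [Function.update_of_ne hi, Function.update_of_ne hj,
              Equiv.swap_apply_of_ne_of_ne hi hj]
      rw [hs, add_comm, AlternatingMap.map_swap_add _ _ hne]
    · intro k _ hk
      simp only [Finset.mem_insert, Finset.mem_singleton, not_or] at hk
      refine (exteriorPower.ιMulti K m).map_eq_zero_of_eq _ (i := i) (j := j) ?_ hne
      rw [Function.update_of_ne (Ne.symm hk.1), Function.update_of_ne (Ne.symm hk.2), hij]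

theorem derivationAlt_apply (m : ℕ) (T : g →ₗ[K] g) (y : Fin m → g) :
    derivationAlt m T y =
      ∑ i : Fin m, exteriorPower.ιMulti K m (Function.update y i (T (y i))) := by
  have key : ∀ k : Fin m, (fun l => (if l = k then T else LinearMap.id) (y l)) =
      Function.update y k (T (y k)) := by
    intro k
    funext l
    by_cases h : l = k
    · subst h; simp
    · simp [h]
  change (∑ i : Fin m, (exteriorPower.ιMulti K m).toMultilinearMap.compLinearMap
    (fun j => if j = i then T else LinearMap.id)) y = _
  simp only [sum_apply, MultilinearMap.compLinearMap_apply, key,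
    AlternatingMap.coe_multilinearMap]

/-- The extension of an endomorphism `T` of `g` to a derivation of `⋀ᵐ g`. -/
def derivation (m : ℕ) : (g →ₗ[K] g) →ₗ[K] (⋀[K]^m g →ₗ[K] ⋀[K]^m g) where
  toFun T := exteriorPower.alternatingMapLinearEquiv (derivationAlt m T)
  map_add' S T := by
    rw [← map_add]
    congr 1
    ext1 y
    simp [derivationAlt_apply, Finset.sum_add_distrib, -exteriorPower.ιMulti_apply_coe]
  map_smul' c T := by
    rw [RingHom.id_apply, ← map_smul]
    congr 1
    ext1 y
    simp [derivationAlt_apply, Finset.smul_sum, -exteriorPower.ιMulti_apply_coe]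

@[simp] theorem derivation_ιMulti (m : ℕ) (T : g →ₗ[K] g) (y : Fin m → g) :
    derivation m T (exteriorPower.ιMulti K m y) =
      ∑ i : Fin m, exteriorPower.ιMulti K m (Function.update y i (T (y i))) := by
  rw [← derivationAlt_apply]
  exact exteriorPower.alternatingMapLinearEquiv_apply_ιMulti _ _

variable {W U : Type*} [AddCommGroup W] [Module K W] [AddCommGroup U] [Module K U]

/-- For an alternating map `B` with values in the linear maps `W → U` and a linear map
`α : g → W`, the alternating map
`(x₀, …, xₘ) ↦ ∑ᵢ (-1) ^ (m + i) B(x₀, …, x̂ᵢ, …, xₘ) (α xᵢ)`. -/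
def pairing (m : ℕ) (B : g [⋀^Fin m]→ₗ[K] (W →ₗ[K] U)) :
    (g →ₗ[K] W) →ₗ[K] (g [⋀^Fin (m + 1)]→ₗ[K] U) where
  toFun α := (-1 : K) ^ m • AlternatingMap.alternatizeUncurryFin
    { toFun := fun x => (LinearMap.applyₗ (α x)).compAlternatingMap B
      map_add' := fun x y => by ext; simp
      map_smul' := fun c x => by ext; simp }
  map_add' α β := by
    ext x
    simp [AlternatingMap.alternatizeUncurryFin_apply, Finset.sum_add_distrib]
  map_smul' c α := by
    ext x
    simp [AlternatingMap.alternatizeUncurryFin_apply, Finset.smul_sum, smul_comm _ c]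

theorem pairing_apply (m : ℕ) (B : g [⋀^Fin m]→ₗ[K] (W →ₗ[K] U)) (α : g →ₗ[K] W)
    (x : Fin (m + 1) → g) :
    pairing m B α x =
      ∑ i : Fin (m + 1), (-1 : K) ^ (m + (i : ℕ)) • B (i.removeNth x) (α (x i)) := by
  simp only [pairing, LinearMap.coe_mk, AddHom.coe_mk, AlternatingMap.smul_apply,
    AlternatingMap.alternatizeUncurryFin_apply, Finset.smul_sum]
  refine Finset.sum_congr rfl fun i _ => ?_
  rw [pow_add, mul_smul]
  congr 1
  rcases Nat.even_or_odd (i : ℕ) with h | h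
  · simp [h.neg_one_pow]
  · simp [h.neg_one_pow]

end Multilinear

/-! ### Leibniz cochains -/

section Leibniz

variable {K L A B : Type*} [Field K] [AddCommGroup L] [Module K L] [AddCommGroup A] [Module K A]
  [AddCommGroup B] [Module K B]

/-- The space `Hom(L ⊗ ⋯ ⊗ L, A)` with `p` tensor factors. -/
abbrev LeibnizCochain (K L A : Type*) [Field K] [AddCommGroup L] [Module K L] [AddCommGroup A]
    [Module K A] (p : ℕ) : Type _ :=
  MultilinearMap K (fun _ : Fin p => L) A

/-- `(X₀, …, Xₚ) ↦ a(Xᵢ) (ω(X₀, …, X̂ᵢ, …, Xₚ))`. -/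
def insertAct (a : L →ₗ[K] (A →ₗ[K] B)) {p : ℕ} (i : Fin (p + 1)) :
    LeibnizCochain K L A p →ₗ[K] LeibnizCochain K L B (p + 1) where
  toFun ω := LinearMap.uncurryMid i
    { toFun := fun X => (a X).compMultilinearMap ω
      map_add' := fun X Y => by ext; simp
      map_smul' := fun c X => by ext; simp }
  map_add' ω η := by ext; simp
  map_smul' c ω := by ext; simp

@[simp] theorem insertAct_apply (a : L →ₗ[K] (A →ₗ[K] B)) {p : ℕ} (i : Fin (p + 1))
    (ω : LeibnizCochain K L A p) (X : Fin (p + 1) → L) :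
    insertAct a i ω X = a (X i) (ω (i.removeNth X)) := rfl

theorem circ_compLinearMap (circ : L →ₗ[K] (L →ₗ[K] L)) {p : ℕ} (j : Fin p)
    (ω : LeibnizCochain K L A p) (X : L) (Y : Fin p → L) :
    ω.compLinearMap (Function.update (fun _ => LinearMap.id) j (circ X)) Y =
      ω (Function.update Y j (circ X (Y j))) := by
  rw [MultilinearMap.compLinearMap_apply]
  congr 1
  funext l
  by_cases h : l = j
  · subst h; simp
  · simp [Function.update_of_ne h]

/-- `(X₀, …, Xₚ) ↦ ω(Y₀, …, Xᵢ ∘ Yⱼ, …, Yₚ₋₁)` with `Y = (X₀, …, X̂ᵢ, …, Xₚ)`. -/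
def insertCirc (circ : L →ₗ[K] (L →ₗ[K] L)) {p : ℕ} (i : Fin (p + 1)) (j : Fin p) :
    LeibnizCochain K L A p →ₗ[K] LeibnizCochain K L A (p + 1) where
  toFun ω := LinearMap.uncurryMid i
    { toFun := fun X => ω.compLinearMap (Function.update (fun _ => LinearMap.id) j (circ X))
      map_add' := fun X Y => by
        ext Z
        rw [add_apply]
        rw [circ_compLinearMap, circ_compLinearMap, circ_compLinearMap, map_add,
          LinearMap.add_apply, MultilinearMap.map_update_add]
      map_smul' := fun c X => by
        ext Z
        rw [RingHom.id_apply, smul_apply, circ_compLinearMap, circ_compLinearMap, map_smul,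
          LinearMap.smul_apply, MultilinearMap.map_update_smul] }
  map_add' ω η := by ext; simp
  map_smul' c ω := by ext; simp

@[simp] theorem insertCirc_apply (circ : L →ₗ[K] (L →ₗ[K] L)) {p : ℕ} (i : Fin (p + 1))
    (j : Fin p) (ω : LeibnizCochain K L A p) (X : Fin (p + 1) → L) :
    insertCirc circ i j ω X =
      ω (Function.update (i.removeNth X) j (circ (X i) (i.removeNth X j))) :=
  circ_compLinearMap circ j ω (X i) (i.removeNth X)

/-- The Leibniz coboundary operator `Hom(L^{⊗p}, A) → Hom(L^{⊗(p+1)}, A)` of a Leibniz algebra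
`(L, ∘)` with left action `l(X)(a) = [X, a]_L` and right action `r(X)(a) = [a, X]_R` on `A`. In
one-based indices, and with `q = p + 1`,
`dω(X₁, …, X_q) = ∑_{i < q} (-1)^{i+1} [Xᵢ, ω(…, X̂ᵢ, …)]_L + (-1)^q [ω(X₁, …, X_p), X_q]_R
  + ∑_{i < j ≤ q} (-1)^i ω(…, X̂ᵢ, …, Xᵢ ∘ Xⱼ, …)`;
see `leibnizCoboundary_apply`. -/
def leibnizCoboundary (circ : L →ₗ[K] (L →ₗ[K] L)) (l r : L →ₗ[K] (A →ₗ[K] A)) (p : ℕ) :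
    LeibnizCochain K L A p →ₗ[K] LeibnizCochain K L A (p + 1) :=
  (∑ i : Fin p, (-1 : K) ^ (i : ℕ) • insertAct l i.castSucc) +
  (-1 : K) ^ (p + 1) • insertAct r (Fin.last p) +
  ∑ i : Fin (p + 1), ∑ j : Fin p,
    if i ≤ j.castSucc then (-1 : K) ^ ((i : ℕ) + 1) • insertCirc circ i j else 0

/-- For `i ≤ j` the entry `j` of `(X₀, …, X̂ᵢ, …, Xₚ)` is `Xⱼ₊₁`, so the last sum runs over the
pairs `Xᵢ`, `Xⱼ₊₁` with `i < j + 1`. -/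
theorem leibnizCoboundary_apply (circ : L →ₗ[K] (L →ₗ[K] L)) (l r : L →ₗ[K] (A →ₗ[K] A)) (p : ℕ)
    (ω : LeibnizCochain K L A p) (X : Fin (p + 1) → L) :
    leibnizCoboundary circ l r p ω X =
      ∑ i : Fin p, (-1 : K) ^ (i : ℕ) • l (X i.castSucc) (ω (i.castSucc.removeNth X)) +
      (-1 : K) ^ (p + 1) • r (X (Fin.last p)) (ω (Fin.init X)) +
      ∑ i : Fin (p + 1), ∑ j : Fin p, if i ≤ j.castSucc then
        (-1 : K) ^ ((i : ℕ) + 1) •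
          ω (Function.update (i.removeNth X) j (circ (X i) (X j.succ))) else 0 := by
  simp only [leibnizCoboundary, LinearMap.add_apply, add_apply, LinearMap.sum_apply, sum_apply,
    LinearMap.smul_apply, smul_apply, insertAct_apply, Fin.removeNth_last]
  congr 1
  refine Finset.sum_congr rfl fun i _ => Finset.sum_congr rfl fun j _ => ?_
  split_ifs with h
  · simp only [LinearMap.smul_apply, smul_apply, insertCirc_apply]
    have e : i.removeNth X j = X j.succ := by
      rw [Fin.removeNth_apply, Fin.succAbove_of_le_castSucc i j h]
    rw [e]
  · rfl

/-- Composition of cochains with a linear map of the coefficients. -/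
def mapCoeff (T : A →ₗ[K] B) (p : ℕ) : LeibnizCochain K L A p →ₗ[K] LeibnizCochain K L B p where
  toFun ω := T.compMultilinearMap ω
  map_add' ω η := by ext; simp
  map_smul' c ω := by ext; simp

@[simp] theorem mapCoeff_apply (T : A →ₗ[K] B) (p : ℕ) (ω : LeibnizCochain K L A p)
    (X : Fin p → L) : mapCoeff T p ω X = T (ω X) := rfl

end Leibniz

/-! ### The Leibniz algebra of fundamental objects and its actions -/

section Fundamental

variable {d : ℕ} {K g : Type*} [Field K] [AddCommGroup g] [Module K g]

/-- The space `L = ⋀ⁿ⁻¹ g` of fundamental objects. -/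
abbrev Fund (d : ℕ) (K g : Type*) [Field K] [AddCommGroup g] [Module K g] : Type _ :=
  ⋀[K]^(d + 1) g

/-- `ad(x₁ ∧ … ∧ xₙ₋₁)(z) = [x₁, …, xₙ₋₁, z]`. -/
def NLieAlgebra.ad (A : NLieAlgebra d K g) : Fund d K g →ₗ[K] (g →ₗ[K] g) :=
  exteriorPower.alternatingMapLinearEquiv (curryLast (d + 1) A.bracket)

/-- `X ∘ (y₁ ∧ … ∧ yₙ₋₁) = ∑ᵢ y₁ ∧ … ∧ ad(X) yᵢ ∧ … ∧ yₙ₋₁`. -/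
def NLieAlgebra.circ (A : NLieAlgebra d K g) :
    Fund d K g →ₗ[K] (Fund d K g →ₗ[K] Fund d K g) :=
  derivation (d + 1) ∘ₗ A.ad

theorem NLieAlgebra.ad_ιMulti (A : NLieAlgebra d K g) (x : Fin (d + 1) → g) (z : g) :
    A.ad (exteriorPower.ιMulti K (d + 1) x) z = A.bracket (Fin.snoc x z) := by
  rw [NLieAlgebra.ad, exteriorPower.alternatingMapLinearEquiv_apply_ιMulti, curryLast_apply]

theorem NLieAlgebra.circ_ιMulti (A : NLieAlgebra d K g) (x y : Fin (d + 1) → g) :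
    A.circ (exteriorPower.ιMulti K (d + 1) x) (exteriorPower.ιMulti K (d + 1) y) =
      ∑ i, exteriorPower.ιMulti K (d + 1)
        (Function.update y i (A.bracket (Fin.snoc x (y i)))) := by
  simp only [NLieAlgebra.circ, LinearMap.comp_apply, derivation_ιMulti, A.ad_ιMulti]

variable {A : NLieAlgebra d K g} {V W : Type*} [AddCommGroup V] [Module K V]
  [AddCommGroup W] [Module K W]

/-- The action of fundamental objects: `x₁ ∧ … ∧ xₙ₋₁ ↦ ρ(x₁, …, xₙ₋₁)`. -/
def Representation.fund (ρ : Representation A V) : Fund d K g →ₗ[K] (V →ₗ[K] V) :=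
  exteriorPower.alternatingMapLinearEquiv ρ.act

theorem Representation.fund_ιMulti (ρ : Representation A V) (x : Fin (d + 1) → g) :
    ρ.fund (exteriorPower.ιMulti K (d + 1) x) = ρ.act x :=
  exteriorPower.alternatingMapLinearEquiv_apply_ιMulti _ _

/-- The left action on `Hom(g, V)`: `[X, φ]_L (z) = ρ(X) φ(z) - φ([X, z])`. -/
def Representation.left (ρ : Representation A V) :
    Fund d K g →ₗ[K] ((g →ₗ[K] V) →ₗ[K] (g →ₗ[K] V)) :=
  LinearMap.mk₂ K (fun X φ => ρ.fund X ∘ₗ φ - φ ∘ₗ A.ad X)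
    (fun X Y φ => by ext; simp; abel) (fun c X φ => by ext; simp [smul_sub])
    (fun X φ ψ => by ext; simp; abel) (fun c X φ => by ext; simp [smul_sub])

theorem Representation.left_apply (ρ : Representation A V) (X : Fund d K g) (φ : g →ₗ[K] V)
    (z : g) : ρ.left X φ z = ρ.fund X (φ z) - φ (A.ad X z) := rfl

/-- The right action on `Hom(g, V)`:
`[φ, x₁ ∧ … ∧ xₙ₋₁]_R (xₙ) = φ([x₁, …, xₙ]) - ∑ᵢ (-1)ⁿ⁻ⁱ ρ(x₁, …, x̂ᵢ, …, xₙ) φ(xᵢ)`;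
see `Representation.right_ιMulti`. -/
def Representation.right (ρ : Representation A V) :
    Fund d K g →ₗ[K] ((g →ₗ[K] V) →ₗ[K] (g →ₗ[K] V)) :=
  LinearMap.mk₂ K
    (fun X φ => φ ∘ₗ A.ad X -
      exteriorPower.alternatingMapLinearEquiv (curryLast (d + 1) (pairing (d + 1) ρ.act φ)) X)
    (fun X Y φ => by simp only [map_add, LinearMap.comp_add]; abel)
    (fun c X φ => by simp only [map_smul, LinearMap.comp_smul, smul_sub])
    (fun X φ ψ => by simp only [map_add, LinearMap.add_comp, LinearMap.add_apply]; abel)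
    (fun c X φ => by simp only [map_smul, LinearMap.smul_comp, LinearMap.smul_apply, smul_sub])

theorem Representation.right_ιMulti (ρ : Representation A V) (x : Fin (d + 1) → g)
    (φ : g →ₗ[K] V) (z : g) :
    ρ.right (exteriorPower.ιMulti K (d + 1) x) φ z =
      φ (A.bracket (Fin.snoc x z)) -
        ∑ i : Fin (d + 2), (-1 : K) ^ (d + 1 + (i : ℕ)) •
          ρ.act (i.removeNth (Fin.snoc x z : Fin (d + 2) → g))
            (φ ((Fin.snoc x z : Fin (d + 2) → g) i)) := by
  simp only [Representation.right, LinearMap.mk₂_apply, LinearMap.sub_apply,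
    LinearMap.comp_apply, A.ad_ιMulti, exteriorPower.alternatingMapLinearEquiv_apply_ιMulti,
    curryLast_apply, pairing_apply]

/-- The action on the linear maps between two representations:
`(X · ν)(m) = ρ'(X) ν(m) - ν(ρ(X) m)`. -/
def homAct (ρ : Representation A V) (ρ' : Representation A W) :
    Fund d K g →ₗ[K] ((V →ₗ[K] W) →ₗ[K] (V →ₗ[K] W)) :=
  LinearMap.mk₂ K (fun X ν => ρ'.fund X ∘ₗ ν - ν ∘ₗ ρ.fund X)
    (fun X Y φ => by ext; simp; abel) (fun c X φ => by ext; simp [smul_sub])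
    (fun X φ ψ => by ext; simp; abel) (fun c X φ => by ext; simp [smul_sub])

theorem homAct_apply (ρ : Representation A V) (ρ' : Representation A W) (X : Fund d K g)
    (ν : V →ₗ[K] W) (m : V) : homAct ρ ρ' X ν m = ρ'.fund X (ν m) - ν (ρ.fund X m) := rfl

/-- The coboundary of an `n`-Lie algebra with coefficients in `V`: the Leibniz coboundary of `L`
with coefficients in the bimodule `Hom(g, V)`. -/
def Representation.delta (ρ : Representation A V) (p : ℕ) :
    LeibnizCochain K (Fund d K g) (g →ₗ[K] V) p →ₗ[K]
      LeibnizCochain K (Fund d K g) (g →ₗ[K] V) (p + 1) :=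
  leibnizCoboundary A.circ ρ.left ρ.right p

/-- The coboundary with coefficients in the `g`-module `Hom(V, W)`: the Leibniz coboundary of `L`
with `[X, ν]_L = X · ν` and `[ν, X]_R = - X · ν`. -/
def deltaHom (ρ : Representation A V) (ρ' : Representation A W) (p : ℕ) :
    LeibnizCochain K (Fund d K g) (V →ₗ[K] W) p →ₗ[K]
      LeibnizCochain K (Fund d K g) (V →ₗ[K] W) (p + 1) :=
  leibnizCoboundary A.circ (homAct ρ ρ') (-homAct ρ ρ') p

end Fundamental

/-! ### The cochain complex of an `n`-Lie algebra in the category of linear maps -/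

section Complex

variable {d : ℕ} {K M g V W : Type*} [Field K] [AddCommGroup M] [Module K M]
  [AddCommGroup g] [Module K g] [AddCommGroup V] [Module K V] [AddCommGroup W] [Module K W]

/-- The third summand `Hom(L^{⊗(k-1)}, Hom(M, W))` of the `k`-cochains; it is `0` for `k = 0`. -/
def ThirdCochain (d : ℕ) (K M g W : Type*) [Field K] [AddCommGroup M] [Module K M]
    [AddCommGroup g] [Module K g] [AddCommGroup W] [Module K W] : ℕ → Type _
  | 0 => PUnit
  | k + 1 => LeibnizCochain K (Fund d K g) (M →ₗ[K] W) k

instance instAddCommGroupThirdCochain : ∀ k, AddCommGroup (ThirdCochain d K M g W k)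
  | 0 => (inferInstance : AddCommGroup PUnit)
  | k + 1 => (inferInstance : AddCommGroup (LeibnizCochain K (Fund d K g) (M →ₗ[K] W) k))

instance instModuleThirdCochain.{uK, uM, ug, uW} {d : ℕ} {K : Type uK} {M : Type uM} {g : Type ug}
    {W : Type uW} [Field K] [AddCommGroup M] [Module K M] [AddCommGroup g] [Module K g]
    [AddCommGroup W] [Module K W] : ∀ k, Module K (ThirdCochain d K M g W k)
  | 0 => (inferInstance : Module K PUnit.{max (max (max uW ug) uM) uK + 1})
  | k + 1 => (inferInstance : Module K (LeibnizCochain K (Fund d K g) (M →ₗ[K] W) k))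

/-- The `k`-cochains
`Hom(L^{⊗k}, Hom(g, W)) ⊕ Hom(L^{⊗k}, Hom(M, V)) ⊕ Hom(L^{⊗(k-1)}, Hom(M, W))`. -/
def Cochain (d : ℕ) (K M g V W : Type*) [Field K] [AddCommGroup M] [Module K M]
    [AddCommGroup g] [Module K g] [AddCommGroup V] [Module K V] [AddCommGroup W] [Module K W]
    (k : ℕ) : Type _ :=
  LeibnizCochain K (Fund d K g) (g →ₗ[K] W) k ×
    LeibnizCochain K (Fund d K g) (M →ₗ[K] V) k × ThirdCochain d K M g W k

instance instAddCommGroupCochain (k : ℕ) : AddCommGroup (Cochain d K M g V W k) :=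
  inferInstanceAs (AddCommGroup (LeibnizCochain K (Fund d K g) (g →ₗ[K] W) k ×
    LeibnizCochain K (Fund d K g) (M →ₗ[K] V) k × ThirdCochain d K M g W k))

instance instModuleCochain (k : ℕ) : Module K (Cochain d K M g V W k) :=
  inferInstanceAs (Module K (LeibnizCochain K (Fund d K g) (g →ₗ[K] W) k ×
    LeibnizCochain K (Fund d K g) (M →ₗ[K] V) k × ThirdCochain d K M g W k))

namespace Cochain

variable {k : ℕ}

@[simp] theorem add_fst (a b : Cochain d K M g V W k) : (a + b).1 = a.1 + b.1 := rfl

@[simp] theorem add_snd_fst (a b : Cochain d K M g V W k) :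
    (a + b).2.1 = a.2.1 + b.2.1 := rfl

@[simp] theorem add_snd_snd (a b : Cochain d K M g V W k) :
    (a + b).2.2 = a.2.2 + b.2.2 := rfl

@[simp] theorem smul_fst (c : K) (a : Cochain d K M g V W k) : (c • a).1 = c • a.1 := rfl

@[simp] theorem smul_snd_fst (c : K) (a : Cochain d K M g V W k) :
    (c • a).2.1 = c • a.2.1 := rfl

@[simp] theorem smul_snd_snd (c : K) (a : Cochain d K M g V W k) :
    (c • a).2.2 = c • a.2.2 := rfl

@[simp] theorem zero_fst : (0 : Cochain d K M g V W k).1 = 0 := rfl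

@[simp] theorem zero_snd_fst : (0 : Cochain d K M g V W k).2.1 = 0 := rfl

@[simp] theorem zero_snd_snd : (0 : Cochain d K M g V W k).2.2 = 0 := rfl

theorem ext {a b : Cochain d K M g V W k} (h₁ : a.1 = b.1) (h₂ : a.2.1 = b.2.1)
    (h₃ : a.2.2 = b.2.2) : a = b :=
  Prod.ext h₁ (Prod.ext h₂ h₃)

end Cochain

namespace LMRepresentation

variable {A : NLieLM d K M g} (R : LMRepresentation A V W)

/-- `δ₁`, with coefficients in `W`. -/
def delta₁ (k : ℕ) : LeibnizCochain K (Fund d K g) (g →ₗ[K] W) k →ₗ[K]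
    LeibnizCochain K (Fund d K g) (g →ₗ[K] W) (k + 1) :=
  R.rho₂.delta k

/-- `δ₂`, with coefficients in `Hom(M, V)`. -/
def delta₂ (k : ℕ) : LeibnizCochain K (Fund d K g) (M →ₗ[K] V) k →ₗ[K]
    LeibnizCochain K (Fund d K g) (M →ₗ[K] V) (k + 1) :=
  deltaHom A.rep R.rho₁ k

/-- `δ₃`, with coefficients in `Hom(M, W)`. -/
def delta₃ : ∀ k : ℕ, ThirdCochain d K M g W k →ₗ[K] ThirdCochain d K M g W (k + 1)
  | 0 => 0
  | k + 1 => deltaHom A.rep R.rho₂ k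

/-- The map `L → Hom(Hom(g, W), Hom(M, V))` that takes `x₁ ∧ … ∧ xₙ₋₁` to
`α ↦ (m ↦ ∑ᵢ (-1)ⁿ⁻ⁱ ρ₃(x₁, …, x̂ᵢ, …, xₙ₋₁, m) (α xᵢ))`; see `rho₃Act_ιMulti`. -/
def rho₃Act : Fund d K g →ₗ[K] ((g →ₗ[K] W) →ₗ[K] (M →ₗ[K] V)) :=
  LinearMap.mk₂ K
    (fun X α => -exteriorPower.alternatingMapLinearEquiv
      (pairing d ((LinearMap.lflip (R₀ := K)).compAlternatingMap R.rho₃) α) X)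
    (fun X Y α => by simp only [map_add, neg_add])
    (fun c X α => by simp only [map_smul, smul_neg])
    (fun X α β => by simp only [map_add, neg_add, LinearMap.add_apply])
    (fun c X α => by simp only [map_smul, smul_neg, LinearMap.smul_apply])

theorem rho₃Act_ιMulti (x : Fin (d + 1) → g) (α : g →ₗ[K] W) (m : M) :
    R.rho₃Act (exteriorPower.ιMulti K (d + 1) x) α m =
      ∑ i : Fin (d + 1), (-1 : K) ^ (d + 1 + (i : ℕ)) • R.rho₃ (i.removeNth x) m (α (x i)) := by
  simp only [rho₃Act, LinearMap.mk₂_apply, exteriorPower.alternatingMapLinearEquiv_apply_ιMulti,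
    LinearMap.neg_apply, pairing_apply, LinearMap.sum_apply, LinearMap.smul_apply]
  rw [← Finset.sum_neg_distrib]
  refine Finset.sum_congr rfl fun i _ => ?_
  rw [← neg_smul]
  congr 1
  ring

/-- `h₁(ω)(X₁, …, Xₖ₊₁)(m) = -∑ᵢ (-1)ⁿ⁻ⁱ ρ₃(x₁, …, x̂ᵢ, …, xₙ₋₁, m) ω(X₁, …, Xₖ, xᵢ)` for
`Xₖ₊₁ = x₁ ∧ … ∧ xₙ₋₁`. For `n = 2` this is `ρ₃(m) ω(X₁, …, Xₖ₊₁)`. -/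
def h₁ (k : ℕ) : LeibnizCochain K (Fund d K g) (g →ₗ[K] W) k →ₗ[K]
    LeibnizCochain K (Fund d K g) (M →ₗ[K] V) (k + 1) :=
  -insertAct R.rho₃Act (Fin.last k)

/-- `h₂(ω)(X₁, …, Xₖ)(m) = (-1)ᵏ ω(X₁, …, Xₖ, f(m))`. -/
def h₂ (_R : LMRepresentation A V W) (k : ℕ) :
    LeibnizCochain K (Fund d K g) (g →ₗ[K] W) k →ₗ[K] ThirdCochain d K M g W (k + 1) :=
  (-1 : K) ^ k • mapCoeff (LinearMap.lcomp K W A.f) k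

/-- `φ♯(ν)(X₁, …, Xₖ)(m) = φ(ν(X₁, …, Xₖ)(m))`. -/
def φSharp (k : ℕ) : LeibnizCochain K (Fund d K g) (M →ₗ[K] V) k →ₗ[K]
    ThirdCochain d K M g W (k + 1) :=
  mapCoeff (LinearMap.llcomp K M V W R.φ) k

/-- `D(ω, ν, θ) = (-δ₁ω, -h₁ω + δ₂ν, -h₂ω + φ♯ν - δ₃θ)`. -/
def D (k : ℕ) : Cochain d K M g V W k →ₗ[K] Cochain d K M g V W (k + 1) where
  toFun c :=
    (-R.delta₁ k c.1, -R.h₁ k c.1 + R.delta₂ k c.2.1,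
      -R.h₂ k c.1 + R.φSharp k c.2.1 - R.delta₃ k c.2.2)
  map_add' c c' := by
    refine Cochain.ext ?_ ?_ ?_
    · change -R.delta₁ k (c.1 + c'.1) = -R.delta₁ k c.1 + -R.delta₁ k c'.1
      rw [map_add, neg_add]
    · change -R.h₁ k (c.1 + c'.1) + R.delta₂ k (c.2.1 + c'.2.1) =
        (-R.h₁ k c.1 + R.delta₂ k c.2.1) + (-R.h₁ k c'.1 + R.delta₂ k c'.2.1)
      rw [map_add, map_add]
      abel
    · change -R.h₂ k (c.1 + c'.1) + R.φSharp k (c.2.1 + c'.2.1) - R.delta₃ k (c.2.2 + c'.2.2) =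
        (-R.h₂ k c.1 + R.φSharp k c.2.1 - R.delta₃ k c.2.2) +
          (-R.h₂ k c'.1 + R.φSharp k c'.2.1 - R.delta₃ k c'.2.2)
      rw [map_add, map_add, map_add]
      abel
  map_smul' a c := by
    refine Cochain.ext ?_ ?_ ?_
    · change -R.delta₁ k (a • c.1) = a • -R.delta₁ k c.1
      rw [map_smul, smul_neg]
    · change -R.h₁ k (a • c.1) + R.delta₂ k (a • c.2.1) =
        a • (-R.h₁ k c.1 + R.delta₂ k c.2.1)
      rw [map_smul, map_smul, smul_add, smul_neg]
    · change -R.h₂ k (a • c.1) + R.φSharp k (a • c.2.1) - R.delta₃ k (a • c.2.2) =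
        a • (-R.h₂ k c.1 + R.φSharp k c.2.1 - R.delta₃ k c.2.2)
      rw [map_smul, map_smul, map_smul, smul_sub, smul_add, smul_neg]

/-- The `k`-cocycles. -/
def cocycles (k : ℕ) : Submodule K (Cochain d K M g V W k) := LinearMap.ker (R.D k)

/-- The `k`-coboundaries; there are none but `0` for `k = 0`. -/
def coboundaries : ∀ k : ℕ, Submodule K (Cochain d K M g V W k)
  | 0 => ⊥
  | k + 1 => LinearMap.range (R.D k)

/-- The cohomology group `Hᵏ((M, g, f), (V, W, φ)) = Zᵏ / Bᵏ`. -/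
abbrev Cohomology (k : ℕ) : Type _ :=
  R.cocycles k ⧸ (R.coboundaries k).submoduleOf (R.cocycles k)

end LMRepresentation

/-- The cochains `(ω, ν, θ)` whose `ω` is skew-symmetric in its last `n` arguments from `g`, so
that `ω` is in `Hom(g, W)` for `k = 0` and in `Hom(L^{⊗(k-1)} ⊗ ⋀ⁿ g, W)` for `k ≥ 1`. -/
def skewCochains (d : ℕ) (K M g V W : Type*) [Field K] [AddCommGroup M] [Module K M]
    [AddCommGroup g] [Module K g] [AddCommGroup V] [Module K V] [AddCommGroup W] [Module K W] :
    ∀ k : ℕ, Submodule K (Cochain d K M g V W k)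
  | 0 => ⊤
  | k + 1 =>
    { carrier := {c | ∀ (X : Fin k → Fund d K g) (x : Fin (d + 1) → g) (i : Fin (d + 1)),
        c.1 (Fin.snoc X (exteriorPower.ιMulti K (d + 1) x)) (x i) = 0}
      add_mem' := fun {a b} ha hb X x i => by
        rw [Cochain.add_fst, add_apply, LinearMap.add_apply, ha X x i, hb X x i,
          add_zero]
      zero_mem' := fun X x i => rfl
      smul_mem' := fun c a ha X x i => by
        rw [Cochain.smul_fst, smul_apply, LinearMap.smul_apply, ha X x i,
          smul_zero] }

/-- The cochains `ω` in `Hom(L^{⊗p}, E)` that are totally skew-symmetric in their `p(n-1)` arguments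
from `g`, that is, the subspace `Hom(⋀^{p(n-1)} g, E)`. -/
def altLeibniz (d : ℕ) (K g E : Type*) [Field K] [AddCommGroup g] [Module K g]
    [AddCommGroup E] [Module K E] (p : ℕ) : Submodule K (LeibnizCochain K (Fund d K g) E p) where
  carrier := {ω | ∀ (x : Fin p → Fin (d + 1) → g) (s t : Fin p × Fin (d + 1)), s ≠ t →
    x s.1 s.2 = x t.1 t.2 → ω (fun a => exteriorPower.ιMulti K (d + 1) (x a)) = 0}
  add_mem' := fun {a b} ha hb x s t hst h => by
    rw [add_apply, ha x s t hst h, hb x s t hst h, add_zero]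
  zero_mem' := fun x s t hst h => rfl
  smul_mem' := fun c a ha x s t hst h => by
    rw [smul_apply, ha x s t hst h, smul_zero]

/-- The totally skew-symmetric elements of the third summand. -/
def altThird (d : ℕ) (K M g W : Type*) [Field K] [AddCommGroup M] [Module K M]
    [AddCommGroup g] [Module K g] [AddCommGroup W] [Module K W] :
    ∀ k : ℕ, Submodule K (ThirdCochain d K M g W k)
  | 0 => ⊤
  | k + 1 => altLeibniz d K g (M →ₗ[K] W) k

/-- The totally skew-symmetric cochains, that is, the subspace
`Hom(⋀^{k(n-1)+1} g, W) ⊕ Hom(⋀^{k(n-1)} g, Hom(M, V)) ⊕ Hom(⋀^{(k-1)(n-1)} g, Hom(M, W))`. -/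
def altCochains (d : ℕ) (K M g V W : Type*) [Field K] [AddCommGroup M] [Module K M]
    [AddCommGroup g] [Module K g] [AddCommGroup V] [Module K V] [AddCommGroup W] [Module K W]
    (k : ℕ) : Submodule K (Cochain d K M g V W k) where
  carrier := {c | c.1 ∈ altLeibniz d K g (g →ₗ[K] W) k ∧
    (∀ (x : Fin k → Fin (d + 1) → g) (s : Fin k × Fin (d + 1)),
      c.1 (fun a => exteriorPower.ιMulti K (d + 1) (x a)) (x s.1 s.2) = 0) ∧
    c.2.1 ∈ altLeibniz d K g (M →ₗ[K] V) k ∧ c.2.2 ∈ altThird d K M g W k}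
  add_mem' := fun {a b} ha hb =>
    ⟨add_mem ha.1 hb.1,
      fun x s => by
        rw [Cochain.add_fst, add_apply, LinearMap.add_apply, ha.2.1 x s, hb.2.1 x s, add_zero],
      add_mem ha.2.2.1 hb.2.2.1, add_mem ha.2.2.2 hb.2.2.2⟩
  zero_mem' := ⟨zero_mem _, fun x s => rfl, zero_mem _, zero_mem _⟩
  smul_mem' := fun c a ha =>
    ⟨Submodule.smul_mem _ c ha.1,
      fun x s => by
        rw [Cochain.smul_fst, smul_apply, LinearMap.smul_apply, ha.2.1 x s, smul_zero],
      Submodule.smul_mem _ c ha.2.2.1, Submodule.smul_mem _ c ha.2.2.2⟩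

end Complex

end NLie

end

/-!
The proof rests on Cartan's calculus for Leibniz cochains. Let `ι_X` be the contraction with `X` in
the first argument (`contract`) and `θ_X` the diagonal action of `X` on cochains (`lieAct`). The
coboundary is determined by its value in degree `0` and by Cartan's formula `ι_X d + d ι_X = θ_X`
(`contract_leibnizCoboundary`). Together with `ι_Y θ_X = θ_X ι_Y - ι_{X ∘ Y}`, this turns every
identity between operators on cochains into an induction on the degree whose base case is an axiom
on the coefficients. In this way one gets `[θ_X, θ_Y] = θ_{X ∘ Y}`, then `[θ_X, d] = 0`, then
`d² = 0` for any bimodule over a left Leibniz algebra, and the commutation of `d` with the insertion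
of a last argument through an equivariant map (`leibnizCoboundary_insertAct_last`).

It remains to check axioms on decomposable elements of `⋀ⁿ⁻¹ g`. The fundamental identity makes
`⋀ⁿ⁻¹ g` a Leibniz algebra; `Hom(g, W)` and the spaces of maps between representations are
bimodules over it. The equivariance of the right action on `Hom(g, W)` and that of `ρ₃` are the
same computation, `pairing_equivariant`. The remaining axioms follow from the observation that
`[X, α]_L + [α, X]_R` is a combination of maps `z ↦ ρ₂(u₁, …, uₙ₋₂, z) w`
(`Representation.left_add_right`), on which the right action vanishes and `ρ₃` is computed by its
compatibility with `ρ`. Then `D² = 0` follows from `δᵢ² = 0`, `h₁ δ₁ = δ₂ h₁`, `φ♯ δ₂ = δ₃ φ♯` and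
`h₂ δ₁ + δ₃ h₂ = φ♯ h₁`.

The two subspaces of cochains are handled by the same induction: both are stable under `θ_X`, and
both can be recognized on contractions, the alternating one with the extra condition
`ι_X ι_X ω = 0`. For `n = 2` that condition holds for `dω` because `X ∘ X = 0` and, in the
lowest degree, because `[X, ω(X)]_L + [ω(X), X]_R = 0` (`IsAlt.leibnizCoboundary`).
-/

noncomputable section

namespace NLie

/-! ### Cartan calculus on Leibniz cochains -/

section Cartan

variable {K L A B : Type*} [Field K] [AddCommGroup L] [Module K L] [AddCommGroup A] [Module K A]
  [AddCommGroup B] [Module K B]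

/-- The contraction `ω ↦ ω(X, -, …, -)` of a cochain with `X` in its first argument. -/
def contract (X : L) (p : ℕ) : LeibnizCochain K L A (p + 1) →ₗ[K] LeibnizCochain K L A p where
  toFun ω := ω.curryLeft X
  map_add' ω η := by ext; simp
  map_smul' c ω := by ext; simp

@[simp] theorem contract_apply (X : L) (p : ℕ) (ω : LeibnizCochain K L A (p + 1))
    (Y : Fin p → L) : contract X p ω Y = ω (Fin.cons X Y) := rfl

theorem contract_add (X Y : L) (p : ℕ) (ω : LeibnizCochain K L A (p + 1)) :
    contract (X + Y) p ω = contract X p ω + contract Y p ω :=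
  map_add ω.curryLeft X Y

theorem contract_zero (p : ℕ) (ω : LeibnizCochain K L A (p + 1)) :
    contract 0 p ω = 0 :=
  map_zero ω.curryLeft

theorem contract_ext {p : ℕ} {ω η : LeibnizCochain K L A (p + 1)}
    (h : ∀ X, contract X p ω = contract X p η) : ω = η := by
  ext Y
  rw [← Fin.cons_self_tail Y]
  exact congrArg (fun ζ : LeibnizCochain K L A p => ζ (Fin.tail Y)) (h (Y 0))

/-- The action `ω ↦ (Y ↦ [X, ω(Y)]_L - ∑ⱼ ω(Y₁, …, X ∘ Yⱼ, …, Yₚ))` of `X` on cochains. -/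
def lieAct (circ : L →ₗ[K] (L →ₗ[K] L)) (l : L →ₗ[K] (A →ₗ[K] A)) (X : L) (p : ℕ) :
    LeibnizCochain K L A p →ₗ[K] LeibnizCochain K L A p where
  toFun ω := mapCoeff (l X) p ω -
    ∑ j : Fin p, ω.compLinearMap (Function.update (fun _ => LinearMap.id) j (circ X))
  map_add' ω η := by
    ext Y
    simp [Finset.sum_add_distrib]
    abel
  map_smul' c ω := by
    ext Y
    simp [smul_sub, Finset.smul_sum]

theorem lieAct_apply (circ : L →ₗ[K] (L →ₗ[K] L)) (l : L →ₗ[K] (A →ₗ[K] A)) (X : L) (p : ℕ)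
    (ω : LeibnizCochain K L A p) (Y : Fin p → L) :
    lieAct circ l X p ω Y = l X (ω Y) - ∑ j, ω (Function.update Y j (circ X (Y j))) := by
  simp only [lieAct, LinearMap.coe_mk, AddHom.coe_mk, sub_apply, mapCoeff_apply, sum_apply,
    circ_compLinearMap]

theorem lieAct_zero_apply (circ : L →ₗ[K] (L →ₗ[K] L)) (l : L →ₗ[K] (A →ₗ[K] A)) (X : L)
    (ω : LeibnizCochain K L A 0) (Y : Fin 0 → L) :
    lieAct circ l X 0 ω Y = l X (ω Y) := by
  simp [lieAct_apply]

theorem contract_lieAct (circ : L →ₗ[K] (L →ₗ[K] L)) (l : L →ₗ[K] (A →ₗ[K] A)) (X Y : L) (p : ℕ)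
    (ω : LeibnizCochain K L A (p + 1)) :
    contract Y p (lieAct circ l X (p + 1) ω) =
      lieAct circ l X p (contract Y p ω) - contract (circ X Y) p ω := by
  ext Z
  simp only [contract_apply, lieAct_apply, sub_apply, Fin.sum_univ_succ, Fin.cons_zero,
    Fin.cons_succ, Fin.update_cons_zero, Fin.cons_update]
  abel

variable {circ : L →ₗ[K] (L →ₗ[K] L)} {l r : L →ₗ[K] (A →ₗ[K] A)}

theorem leibnizCoboundary_zero_apply (ω : LeibnizCochain K L A 0) (X : Fin 1 → L) :
    leibnizCoboundary circ l r 0 ω X = -r (X 0) (ω Fin.elim0) := by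
  rw [leibnizCoboundary_apply, Subsingleton.elim (Fin.init X) Fin.elim0]
  simp

/-- Cartan's formula `ι_X d + d ι_X = θ_X`. -/
theorem contract_leibnizCoboundary (X : L) (p : ℕ) (ω : LeibnizCochain K L A (p + 1)) :
    contract X (p + 1) (leibnizCoboundary circ l r (p + 1) ω) =
      lieAct circ l X (p + 1) ω - leibnizCoboundary circ l r p (contract X p ω) := by
  ext Y
  have hr : ∀ i : Fin (p + 1), i.succ.removeNth (Fin.cons X Y : Fin (p + 2) → L) =
      Fin.cons X (i.removeNth Y) := fun i => by
    funext j
    refine Fin.cases ?_ (fun j => ?_) j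
    · simp [Fin.removeNth_apply]
    · simp [Fin.removeNth_apply]
  have h0 : (0 : Fin (p + 2)).removeNth (Fin.cons X Y : Fin (p + 2) → L) = Y := by
    funext j
    simp [Fin.removeNth_apply]
  have hi : Fin.init (Fin.cons X Y : Fin (p + 2) → L) = Fin.cons X (Fin.init Y) := by
    funext j
    refine Fin.cases ?_ (fun j => ?_) j
    · simp [Fin.init]
    · simp [Fin.init]
  have hl : (Fin.last (p + 1)) = (Fin.last p).succ := rfl
  simp only [contract_apply, sub_apply, lieAct_apply, leibnizCoboundary_apply]
  rw [Fin.sum_univ_succ (n := p), Fin.sum_univ_succ (n := p + 1), Fin.castSucc_zero, h0, hi, hl]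
  simp only [← Fin.succ_castSucc, hr, Fin.cons_succ, Fin.cons_zero, Fin.val_zero, pow_zero,
    one_smul, Fin.val_succ, Fin.zero_le, if_true, zero_add, pow_one, neg_smul]
  simp only [Fin.sum_univ_succ (n := p) (f := fun j => if _ ≤ Fin.castSucc j then _ else _)]
  simp only [Fin.succ_le_succ_iff, ← Fin.succ_castSucc, ← Fin.cons_update, Fin.castSucc_zero,
    Fin.succ_ne_zero, Fin.le_zero_iff, if_false, zero_add, Finset.sum_neg_distrib,
    pow_succ, mul_neg, mul_one, neg_smul, neg_neg]
  have e : ∀ (c : Prop) [Decidable c] (a : A), (if c then -a else 0) = -(if c then a else 0) := by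
    intro c _ a; split_ifs <;> simp
  simp only [e, Finset.sum_neg_distrib]
  abel

section Square

/-- The operation `∘` makes `L` a left Leibniz algebra, and `l`, `r` make `A` a bimodule over it.
The third bimodule axiom is stated in the form `r(Y) (l(X) + r(X)) = 0`, to which it is equivalent
in the presence of the other two. -/
structure IsLeibnizBimodule (circ : L →ₗ[K] (L →ₗ[K] L)) (l r : L →ₗ[K] (A →ₗ[K] A)) : Prop where
  leibniz : ∀ X Y Z : L, circ X (circ Y Z) = circ (circ X Y) Z + circ Y (circ X Z)
  left_circ : ∀ (X Y : L) (a : A), l (circ X Y) a = l X (l Y a) - l Y (l X a)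
  left_right : ∀ (X Y : L) (a : A), l X (r Y a) = r Y (l X a) + r (circ X Y) a
  right_add : ∀ (X Y : L) (a : A), r Y (l X a + r X a) = 0

theorem IsLeibnizBimodule.lieAct_lieAct (h : IsLeibnizBimodule circ l r) (X Y : L) (p : ℕ)
    (ω : LeibnizCochain K L A p) :
    lieAct circ l X p (lieAct circ l Y p ω) - lieAct circ l Y p (lieAct circ l X p ω) =
      lieAct circ l (circ X Y) p ω := by
  induction p with
  | zero => ext Z; simp only [sub_apply, lieAct_zero_apply, h.left_circ]
  | succ p ih =>
    refine contract_ext fun Z => ?_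
    simp only [map_sub, contract_lieAct]
    rw [← ih, h.leibniz X Y Z, contract_add]
    abel

theorem IsLeibnizBimodule.lieAct_leibnizCoboundary (h : IsLeibnizBimodule circ l r) (X : L) (p : ℕ)
    (ω : LeibnizCochain K L A p) :
    lieAct circ l X (p + 1) (leibnizCoboundary circ l r p ω) =
      leibnizCoboundary circ l r p (lieAct circ l X p ω) := by
  induction p with
  | zero =>
    ext Y
    simp [lieAct_apply, leibnizCoboundary_zero_apply, h.left_right]
  | succ p ih =>
    refine contract_ext fun Y => ?_
    rw [contract_lieAct, contract_leibnizCoboundary, contract_leibnizCoboundary,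
      contract_leibnizCoboundary, contract_lieAct, map_sub, map_sub, ih, ← h.lieAct_lieAct]
    abel

theorem IsLeibnizBimodule.leibnizCoboundary_leibnizCoboundary
    (h : IsLeibnizBimodule circ l r) (p : ℕ) (ω : LeibnizCochain K L A p) :
    leibnizCoboundary circ l r (p + 1) (leibnizCoboundary circ l r p ω) = 0 := by
  induction p with
  | zero =>
    refine contract_ext fun X => ?_
    rw [contract_leibnizCoboundary, h.lieAct_leibnizCoboundary, map_zero, ← map_sub]
    ext Y
    have e : (Fin.cons X Fin.elim0 : Fin 1 → L) 0 = X := rfl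
    have h' := h.right_add X (Y 0) (ω Fin.elim0)
    rw [leibnizCoboundary_zero_apply, sub_apply, lieAct_zero_apply, contract_apply,
      leibnizCoboundary_zero_apply, e, sub_neg_eq_add, h', neg_zero, zero_apply]
  | succ p ih =>
    refine contract_ext fun X => ?_
    rw [contract_leibnizCoboundary, contract_leibnizCoboundary,
      h.lieAct_leibnizCoboundary, map_sub, ih]
    simp

end Square

section Maps

variable {l' r' : L →ₗ[K] (B →ₗ[K] B)}

/-- If `T` is compatible with the left actions, it commutes with the coboundaries up to the
defect of compatibility with the right actions. -/
theorem mapCoeff_leibnizCoboundary (T : A →ₗ[K] B) (hT : ∀ X a, T (l X a) = l' X (T a)) (p : ℕ)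
    (ω : LeibnizCochain K L A p) (X : Fin (p + 1) → L) :
    mapCoeff T (p + 1) (leibnizCoboundary circ l r p ω) X =
      leibnizCoboundary circ l' r' p (mapCoeff T p ω) X +
        (-1 : K) ^ (p + 1) • (T (r (X (Fin.last p)) (ω (Fin.init X))) -
          r' (X (Fin.last p)) (T (ω (Fin.init X)))) := by
  simp only [mapCoeff_apply, leibnizCoboundary_apply, map_add, map_sum, map_smul, hT, smul_sub,
    apply_ite T, map_zero]
  abel

theorem contract_insertAct_last (a : L →ₗ[K] (A →ₗ[K] B)) (X : L) (p : ℕ)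
    (ω : LeibnizCochain K L A (p + 1)) :
    contract X (p + 1) (insertAct a (Fin.last (p + 1)) ω) =
      insertAct a (Fin.last p) (contract X p ω) := by
  ext1 Y
  simp only [contract_apply, insertAct_apply, Fin.removeNth_last]
  congr 2
  funext j
  refine Fin.cases ?_ (fun j => ?_) j
  · simp [Fin.init]
  · simp [Fin.init]

theorem lieAct_insertAct_last {a : L →ₗ[K] (A →ₗ[K] B)}
    (ha : ∀ X Y e, l' X (a Y e) = a Y (l X e) + a (circ X Y) e) (X : L) (p : ℕ)
    (ω : LeibnizCochain K L A p) :
    lieAct circ l' X (p + 1) (insertAct a (Fin.last p) ω) =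
      insertAct a (Fin.last p) (lieAct circ l X p ω) := by
  induction p with
  | zero =>
    ext Y
    simp [lieAct_apply, ha]
  | succ p ih =>
    refine contract_ext fun Y => ?_
    rw [contract_lieAct, contract_insertAct_last, contract_insertAct_last,
      contract_insertAct_last, contract_lieAct, map_sub, ih]

/-- Insertion of a last argument through an `L`-equivariant map `a` commutes with the
coboundaries. -/
theorem leibnizCoboundary_insertAct_last {a : L →ₗ[K] (A →ₗ[K] B)}
    (ha : ∀ X Y e, l' X (a Y e) = a Y (l X e) + a (circ X Y) e)
    (har : ∀ X Y e, a Y (l X e + r X e) = -r' Y (a X e)) (p : ℕ)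
    (ω : LeibnizCochain K L A p) :
    leibnizCoboundary circ l' r' (p + 1) (insertAct a (Fin.last p) ω) =
      insertAct a (Fin.last (p + 1)) (leibnizCoboundary circ l r p ω) := by
  induction p with
  | zero =>
    refine contract_ext fun X => ?_
    rw [contract_leibnizCoboundary, lieAct_insertAct_last ha]
    ext1 Y
    have e : ∀ Z : Fin 1 → L, (Fin.last 0).removeNth Z = Fin.elim0 :=
      fun Z => Subsingleton.elim _ _
    have h := har X (Y 0) (ω Fin.elim0)
    have e2 : Fin.init (Fin.cons X Y : Fin 2 → L) 0 = X := rfl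
    have e3 : (Fin.cons X Fin.elim0 : Fin 1 → L) 0 = X := rfl
    have e4 : (Fin.cons X Y : Fin 2 → L) (Fin.last 1) = Y 0 := rfl
    rw [sub_apply, leibnizCoboundary_zero_apply, contract_apply, contract_apply,
      insertAct_apply, insertAct_apply, insertAct_apply, lieAct_zero_apply,
      leibnizCoboundary_zero_apply, e, e, Fin.removeNth_last, e2, Fin.last_zero, e3, e4]
    rw [map_add] at h
    rw [map_neg, sub_neg_eq_add, eq_neg_iff_add_eq_zero, add_right_comm, h, neg_add_cancel]
  | succ p ih =>
    refine contract_ext fun X => ?_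
    rw [contract_leibnizCoboundary, lieAct_insertAct_last ha, contract_insertAct_last,
      contract_insertAct_last, contract_leibnizCoboundary, map_sub, ih]

end Maps

section Alternating

/-- A cochain is alternating if it vanishes when two of its arguments are equal. -/
def IsAlt {p : ℕ} (ω : LeibnizCochain K L A p) : Prop :=
  ∀ (X : Fin p → L) (s t : Fin p), s ≠ t → X s = X t → ω X = 0

/-- An alternating cochain as an alternating map. -/
def IsAlt.toAlternatingMap {p : ℕ} {ω : LeibnizCochain K L A p} (h : IsAlt ω) :
    L [⋀^Fin p]→ₗ[K] A :=
  { ω with map_eq_zero_of_eq' := fun X s t hX hst => h X s t hst hX }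

theorem IsAlt.map_swap {p : ℕ} {ω : LeibnizCochain K L A p} (h : IsAlt ω) (X : Fin p → L)
    {s t : Fin p} (hst : s ≠ t) : ω (X ∘ Equiv.swap s t) = -ω X :=
  h.toAlternatingMap.map_swap X hst

theorem IsAlt.contract {p : ℕ} {ω : LeibnizCochain K L A (p + 1)} (h : IsAlt ω) (X : L) :
    IsAlt (contract X p ω) := fun Y s t hst hY =>
  h (Fin.cons X Y) s.succ t.succ (by simpa using hst) (by simpa using hY)

/-- A cochain is alternating if its contractions are and if it vanishes when its first two arguments
are equal. -/
theorem isAlt_of_contract {p : ℕ} {ω : LeibnizCochain K L A (p + 2)}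
    (h : ∀ X, IsAlt (NLie.contract X (p + 1) ω))
    (h' : ∀ X, NLie.contract X p (NLie.contract X (p + 1) ω) = 0) : IsAlt ω := by
  have key : ∀ (X : Fin (p + 2) → L) (t : Fin (p + 1)), X 0 = X t.succ → ω X = 0 := by
    intro X t hX
    obtain ⟨a, Y, rfl⟩ : ∃ a Y, X = Fin.cons a Y := ⟨X 0, Fin.tail X, (Fin.cons_self_tail X).symm⟩
    rw [Fin.cons_zero, Fin.cons_succ] at hX
    have h0 : ∀ Z : Fin (p + 1) → L, Z 0 = a → ω (Fin.cons a Z) = 0 := by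
      intro Z hZ
      rw [← Fin.cons_self_tail Z, hZ]
      exact congrArg (fun ζ : LeibnizCochain K L A p => ζ (Fin.tail Z)) (h' a)
    rcases eq_or_ne t 0 with rfl | ht
    · exact h0 Y hX.symm
    -- Move the argument equal to `a` to the second place.
    · have := (h a).map_swap Y ht.symm
      rw [contract_apply, contract_apply, h0 _ (by simp [hX])] at this
      exact (neg_eq_zero.mp this.symm)
  intro X s t hst hX
  induction s using Fin.cases with
  | zero =>
    induction t using Fin.cases with
    | zero => exact absurd rfl hst
    | succ t => exact key X t hX
  | succ s =>
    induction t using Fin.cases with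
    | zero => exact key X s hX.symm
    | succ t =>
      have := h (X 0) (Fin.tail X) s t (by simpa using hst) hX
      rwa [contract_apply, Fin.cons_self_tail] at this

theorem IsAlt.sub {p : ℕ} {ω η : LeibnizCochain K L A p} (h : IsAlt ω) (h' : IsAlt η) :
    IsAlt (ω - η) := fun X s t hst hX => by
  rw [sub_apply, h X s t hst hX, h' X s t hst hX, sub_zero]

theorem IsAlt.lieAct {p : ℕ} {ω : LeibnizCochain K L A p} (h : IsAlt ω) (X : L) :
    IsAlt (lieAct circ l X p ω) := by
  intro Y s t hst hY
  rw [lieAct_apply, h Y s t hst hY, map_zero, zero_sub, neg_eq_zero,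
    ← Finset.sum_subset (Finset.subset_univ {s, t}), Finset.sum_pair hst]
  · have e : Function.update Y t (circ X (Y t)) =
        Function.update Y s (circ X (Y s)) ∘ Equiv.swap s t := by
      funext j
      rcases eq_or_ne j s with rfl | hs
      · simp [Function.update_of_ne hst, Function.update_of_ne hst.symm, hY]
      · rcases eq_or_ne j t with rfl | ht
        · simp [hY]
        · simp [Function.update_of_ne hs, Function.update_of_ne ht,
            Equiv.swap_apply_of_ne_of_ne hs ht]
    rw [e, h.map_swap _ hst, add_neg_cancel]
  · intro j _ hj
    simp only [Finset.mem_insert, Finset.mem_singleton, not_or] at hj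
    refine h _ s t hst ?_
    rw [Function.update_of_ne (Ne.symm hj.1), Function.update_of_ne (Ne.symm hj.2), hY]

/-- The coboundary of an alternating cochain is alternating if `X ∘ X = 0` and
`[X, a]_L + [a, X]_R = 0` for every value `a` of the cochain and every argument `X` of that value.
For the coefficients `Hom(g, W)` the second condition does not hold for arbitrary `a` and `X`. -/
theorem IsAlt.leibnizCoboundary (hcirc : ∀ X, circ X X = 0) {p : ℕ}
    {ω : LeibnizCochain K L A p} (h : IsAlt ω)
    (hlr : ∀ (Y : Fin p → L) (s : Fin p), l (Y s) (ω Y) + r (Y s) (ω Y) = 0) :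
    IsAlt (leibnizCoboundary circ l r p ω) := by
  induction p with
  | zero => exact fun X s t hst => absurd (Subsingleton.elim (α := Fin 1) s t) hst
  | succ p ih =>
    refine isAlt_of_contract (fun X => ?_) (fun X => ?_)
    · rw [contract_leibnizCoboundary]
      refine (h.lieAct X).sub (ih (h.contract X) fun Y s => ?_)
      exact hlr (Fin.cons X Y) s.succ
    · rw [contract_leibnizCoboundary, map_sub, contract_lieAct, hcirc, contract_zero, sub_zero]
      cases p with
      | zero =>
        ext1 Y
        have := hlr (Fin.cons X Y) 0
        rw [Fin.cons_zero] at this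
        rw [sub_apply, lieAct_zero_apply, contract_apply, contract_apply,
          leibnizCoboundary_zero_apply, Fin.cons_zero, sub_neg_eq_add, zero_apply, contract_apply,
          Subsingleton.elim Fin.elim0 Y, this]
      | succ p =>
        have h0 : NLie.contract X p (NLie.contract X (p + 1) ω) = 0 := by
          ext Y
          exact h (Fin.cons X (Fin.cons X Y)) 0 1 (by simp) (by simp)
        rw [contract_leibnizCoboundary, h0, map_zero, sub_zero, sub_self]

end Alternating

end Cartan

/-! ### Derivations of exterior powers and of pairings -/

theorem sum_update_snoc {α N : Type*} [AddCommMonoid N] {m : ℕ}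
    (F : (Fin (m + 1) → α) → N) (y : Fin m → α) (z : α)
    (T : α → α) :
    ∑ j, F (Function.update (Fin.snoc y z : Fin (m + 1) → α) j
        (T ((Fin.snoc y z : Fin (m + 1) → α) j))) =
      (∑ j, F (Fin.snoc (Function.update y j (T (y j))) z)) + F (Fin.snoc y (T z)) := by
  simp [Fin.sum_univ_castSucc, Fin.snoc_update, Fin.update_snoc_last]

theorem removeNth_update_self {α : Type*} {m : ℕ} (y : Fin (m + 1) → α) (i : Fin (m + 1)) (z : α) :
    i.removeNth (Function.update y i z) = i.removeNth y := by
  funext k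
  simp [Fin.removeNth_apply]

theorem removeNth_update_succAbove {α : Type*} {m : ℕ} (y : Fin (m + 1) → α) (i : Fin (m + 1))
    (j : Fin m) (z : α) : i.removeNth (Function.update y (i.succAbove j) z) =
      Function.update (i.removeNth y) j z := by
  funext k
  rcases eq_or_ne k j with rfl | h
  · simp [Fin.removeNth_apply]
  · simp [Fin.removeNth_apply, h]

theorem removeNth_castSucc_snoc {α : Type*} {m : ℕ} (y : Fin (m + 1) → α) (z : α)
    (i : Fin (m + 1)) :
    i.castSucc.removeNth (Fin.snoc y z : Fin (m + 2) → α) = Fin.snoc (i.removeNth y) z := by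
  funext k
  refine Fin.lastCases ?_ (fun k => ?_) k
  · simp [Fin.removeNth_apply]
  · have e : i.castSucc.succAbove k.castSucc = (i.succAbove k).castSucc := by
      simp only [Fin.succAbove, Fin.castSucc_lt_castSucc_iff]
      split_ifs <;> rfl
    simp [Fin.removeNth_apply, e]

section Derivation

variable {K g N : Type*} [Field K] [AddCommGroup g] [Module K g] [AddCommGroup N] [Module K N]

/-- Linear maps on an exterior power agree if they agree on decomposable elements. -/
theorem eq_of_ιMulti {m : ℕ} (F G : ⋀[K]^m g →ₗ[K] N)
    (h : ∀ x, F (exteriorPower.ιMulti K m x) = G (exteriorPower.ιMulti K m x))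
    (X : ⋀[K]^m g) : F X = G X := by
  have : F = G := exteriorPower.linearMap_ext (AlternatingMap.ext h)
  rw [this]

/-- The extension of endomorphisms of `g` to derivations of `⋀ᵐ g` is a map of Lie algebras. -/
theorem derivation_commutator (m : ℕ) (S T : g →ₗ[K] g) (Y : ⋀[K]^m g) :
    derivation m (S ∘ₗ T - T ∘ₗ S) Y =
      derivation m S (derivation m T Y) - derivation m T (derivation m S Y) := by
  refine eq_of_ιMulti (derivation m (S ∘ₗ T - T ∘ₗ S))
    (derivation m S ∘ₗ derivation m T - derivation m T ∘ₗ derivation m S) (fun y => ?_) Y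
  simp only [map_sub, LinearMap.sub_apply, LinearMap.comp_apply, derivation_ιMulti, map_sum]
  rw [Finset.sum_comm (f := fun i j => exteriorPower.ιMulti K m (Function.update
    (Function.update y i (S (y i))) j (T (Function.update y i (S (y i)) j))))]
  rw [← Finset.sum_sub_distrib, ← Finset.sum_sub_distrib]
  -- The terms in which `S` and `T` act on different entries cancel.
  refine Finset.sum_congr rfl fun i _ => ?_
  rw [← Finset.sum_sub_distrib, Finset.sum_eq_single i]
  · simp
  · intro j _ hj
    rw [Function.update_of_ne hj, Function.update_of_ne hj.symm, Function.update_comm hj, sub_self]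
  · simp

variable {W U : Type*} [AddCommGroup W] [Module K W] [AddCommGroup U] [Module K U]

/-- If `B` is equivariant for the endomorphisms `T`, `S`, `Q` of `g`, `W`, `U`, so is the pairing
with `B`. -/
theorem pairing_equivariant {m : ℕ} (B : g [⋀^Fin m]→ₗ[K] (W →ₗ[K] U)) (T : g →ₗ[K] g)
    (S : W →ₗ[K] W) (Q : U →ₗ[K] U)
    (h : ∀ x w, Q (B x w) = B x (S w) + ∑ j, B (Function.update x j (T (x j))) w)
    (α : g →ₗ[K] W) (y : Fin (m + 1) → g) :
    Q (pairing m B α y) = pairing m B (S ∘ₗ α - α ∘ₗ T) y +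
      ∑ j, pairing m B α (Function.update y j (T (y j))) := by
  simp only [pairing_apply, map_sum, map_smul, h]
  rw [Finset.sum_comm, ← Finset.sum_add_distrib]
  refine Finset.sum_congr rfl fun i _ => ?_
  rw [← Finset.smul_sum, ← smul_add]
  congr 1
  rw [Fin.sum_univ_succAbove _ i]
  simp only [removeNth_update_self, removeNth_update_succAbove, Function.update_self,
    Function.update_of_ne (Fin.succAbove_ne i _).symm, LinearMap.sub_apply, LinearMap.comp_apply,
    map_sub, Fin.removeNth_apply]
  abel

end Derivation

/-! ### Fundamental objects as a Leibniz algebra -/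

section Fundamental

variable {d : ℕ} {K g : Type*} [Field K] [AddCommGroup g] [Module K g]

/-- `ad(X ∘ Y) = [ad X, ad Y]`: this is the fundamental identity. -/
theorem NLieAlgebra.ad_circ (A : NLieAlgebra d K g) (X Y : Fund d K g) :
    A.ad (A.circ X Y) = A.ad X ∘ₗ A.ad Y - A.ad Y ∘ₗ A.ad X := by
  refine eq_of_ιMulti (A.ad ∘ₗ A.circ.flip Y) (((LinearMap.llcomp K g g g).flip (A.ad Y)) ∘ₗ A.ad -
    (LinearMap.llcomp K g g g (A.ad Y)) ∘ₗ A.ad) (fun x => ?_) X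
  refine eq_of_ιMulti (A.ad ∘ₗ A.circ (exteriorPower.ιMulti K (d + 1) x))
    (LinearMap.llcomp K g g g (A.ad (exteriorPower.ιMulti K (d + 1) x)) ∘ₗ A.ad -
    ((LinearMap.llcomp K g g g).flip (A.ad (exteriorPower.ιMulti K (d + 1) x))) ∘ₗ A.ad)
      (fun y => ?_) Y
  ext z
  simp only [LinearMap.comp_apply, LinearMap.sub_apply, LinearMap.flip_apply,
    LinearMap.llcomp_apply, A.circ_ιMulti, map_sum, LinearMap.sum_apply, A.ad_ιMulti]
  rw [A.fundamental, sum_update_snoc A.bracket y z fun u => A.bracket (Fin.snoc x u)]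
  abel

/-- The operation `∘` makes `⋀ⁿ⁻¹ g` a left Leibniz algebra. -/
theorem NLieAlgebra.circ_circ (A : NLieAlgebra d K g) (X Y Z : Fund d K g) :
    A.circ X (A.circ Y Z) = A.circ (A.circ X Y) Z + A.circ Y (A.circ X Z) := by
  simp only [NLieAlgebra.circ, LinearMap.comp_apply]
  rw [← sub_eq_iff_eq_add, ← derivation_commutator, ← A.ad_circ]
  rfl

variable {A : NLieAlgebra d K g} {V W : Type*} [AddCommGroup V] [Module K V]
  [AddCommGroup W] [Module K W]

theorem Representation.fund_circ (ρ : Representation A V) (X Y : Fund d K g) :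
    ρ.fund (A.circ X Y) = ρ.fund X ∘ₗ ρ.fund Y - ρ.fund Y ∘ₗ ρ.fund X := by
  refine eq_of_ιMulti (ρ.fund ∘ₗ A.circ.flip Y)
    (((LinearMap.llcomp K V V V).flip (ρ.fund Y)) ∘ₗ ρ.fund -
    (LinearMap.llcomp K V V V (ρ.fund Y)) ∘ₗ ρ.fund) (fun x => ?_) X
  refine eq_of_ιMulti (ρ.fund ∘ₗ A.circ (exteriorPower.ιMulti K (d + 1) x))
    (LinearMap.llcomp K V V V (ρ.fund (exteriorPower.ιMulti K (d + 1) x)) ∘ₗ ρ.fund -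
    ((LinearMap.llcomp K V V V).flip (ρ.fund (exteriorPower.ιMulti K (d + 1) x))) ∘ₗ ρ.fund)
      (fun y => ?_) Y
  have h := ρ.act_comm x y
  ext v
  replace h := LinearMap.congr_fun h v
  simp only [LinearMap.comp_apply, LinearMap.sub_apply, LinearMap.flip_apply,
    LinearMap.llcomp_apply, A.circ_ιMulti, map_sum, LinearMap.sum_apply, ρ.fund_ιMulti] at h ⊢
  exact h.symm

theorem Representation.left_circ (ρ : Representation A V) (X Y : Fund d K g) (α : g →ₗ[K] V) :
    ρ.left (A.circ X Y) α = ρ.left X (ρ.left Y α) - ρ.left Y (ρ.left X α) := by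
  ext z
  simp only [LinearMap.sub_apply, Representation.left_apply, ρ.fund_circ, A.ad_circ,
    LinearMap.comp_apply, map_sub]
  abel

/-- The second summand of the right action: `x₁ ∧ … ∧ xₙ₋₁` takes `α` to
`xₙ ↦ ∑ᵢ (-1)ⁿ⁻ⁱ ρ(x₁, …, x̂ᵢ, …, xₙ) α(xᵢ)`. -/
def Representation.pair (ρ : Representation A V) (α : g →ₗ[K] V) :
    Fund d K g →ₗ[K] (g →ₗ[K] V) :=
  exteriorPower.alternatingMapLinearEquiv (curryLast (d + 1) (pairing (d + 1) ρ.act α))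

theorem Representation.pair_ιMulti (ρ : Representation A V) (α : g →ₗ[K] V) (x : Fin (d + 1) → g)
    (z : g) : ρ.pair α (exteriorPower.ιMulti K (d + 1) x) z =
      pairing (d + 1) ρ.act α (Fin.snoc x z) := by
  rw [Representation.pair, exteriorPower.alternatingMapLinearEquiv_apply_ιMulti, curryLast_apply]

theorem Representation.right_eq (ρ : Representation A V) (X : Fund d K g) (α : g →ₗ[K] V) :
    ρ.right X α = α ∘ₗ A.ad X - ρ.pair α X := rfl

theorem Representation.pair_circ (ρ : Representation A V) (X Y : Fund d K g) (α : g →ₗ[K] V)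
    (z : g) : ρ.fund X (ρ.pair α Y z) =
      ρ.pair (ρ.left X α) Y z + ρ.pair α (A.circ X Y) z + ρ.pair α Y (A.ad X z) := by
  refine eq_of_ιMulti (ρ.fund X ∘ₗ (ρ.pair α).flip z) ((ρ.pair (ρ.left X α)).flip z +
    (ρ.pair α).flip z ∘ₗ A.circ X + (ρ.pair α).flip (A.ad X z)) (fun y => ?_) Y
  have hB : ∀ (x : Fin (d + 1) → g) (v : V), ρ.fund X (ρ.act x v) = ρ.act x (ρ.fund X v) +
      ∑ j, ρ.act (Function.update x j (A.ad X (x j))) v := by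
    intro x v
    have h := LinearMap.congr_fun (ρ.fund_circ X (exteriorPower.ιMulti K (d + 1) x)) v
    simp only [NLieAlgebra.circ, LinearMap.comp_apply, derivation_ιMulti, map_sum, ρ.fund_ιMulti,
      LinearMap.sum_apply, LinearMap.sub_apply] at h
    rw [h]
    abel
  have h := pairing_equivariant ρ.act (A.ad X) (ρ.fund X) (ρ.fund X) hB α (Fin.snoc y z)
  rw [sum_update_snoc] at h
  simp only [LinearMap.comp_apply, LinearMap.add_apply, LinearMap.flip_apply, ρ.pair_ιMulti,
    NLieAlgebra.circ, derivation_ιMulti, map_sum, h, ← add_assoc]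
  rfl

theorem Representation.left_right (ρ : Representation A V) (X Y : Fund d K g) (α : g →ₗ[K] V) :
    ρ.left X (ρ.right Y α) = ρ.right Y (ρ.left X α) + ρ.right (A.circ X Y) α := by
  ext z
  simp only [LinearMap.add_apply, LinearMap.sub_apply, Representation.left_apply,
    Representation.right_eq, LinearMap.comp_apply, map_sub, ρ.pair_circ, A.ad_circ]
  abel

/-- The map `z ↦ ρ(u₁, …, uₙ₋₂, z) v`. -/
def Representation.actLast (ρ : Representation A V) (u : Fin d → g) (v : V) : g →ₗ[K] V :=
  (curryLast d ρ.act u).flip v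

theorem Representation.actLast_apply (ρ : Representation A V) (u : Fin d → g) (v : V) (z : g) :
    ρ.actLast u v z = ρ.act (Fin.snoc u z) v := rfl

/-- The values of `[X, ·]_L + [·, X]_R` are combinations of maps `z ↦ ρ(u₁, …, uₙ₋₂, z) v`. -/
theorem Representation.left_add_right (ρ : Representation A V) (x : Fin (d + 1) → g)
    (α : g →ₗ[K] V) :
    ρ.left (exteriorPower.ιMulti K (d + 1) x) α + ρ.right (exteriorPower.ιMulti K (d + 1) x) α =
      -∑ i : Fin (d + 1), (-1 : K) ^ (d + 1 + (i : ℕ)) • ρ.actLast (i.removeNth x) (α (x i)) := by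
  ext z
  have h1 : (-1 : K) ^ (d + 1 + (d + 1)) = 1 := Even.neg_one_pow ⟨d + 1, rfl⟩
  simp only [LinearMap.add_apply, Representation.left_apply,
    Representation.right_ιMulti, A.ad_ιMulti, ρ.fund_ιMulti, Fin.sum_univ_castSucc (n := d + 1),
    LinearMap.neg_apply, LinearMap.sum_apply, LinearMap.smul_apply, ρ.actLast_apply,
    Fin.snoc_castSucc, Fin.snoc_last, Fin.val_castSucc, Fin.val_last, h1, one_smul,
    removeNth_castSucc_snoc, Fin.removeNth_last, Fin.init_snoc]
  abel

/-- This is the formula for `ρ(u₁, …, uₙ₋₂, [y₁, …, yₙ])`. -/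
theorem Representation.right_actLast (ρ : Representation A V) (u : Fin d → g) (v : V)
    (X : Fund d K g) : ρ.right X (ρ.actLast u v) = 0 := by
  refine eq_of_ιMulti (ρ.right.flip (ρ.actLast u v)) 0 (fun x => ?_) X
  ext z
  have h := LinearMap.congr_fun (ρ.act_bracket u (Fin.snoc x z)) v
  simp only [LinearMap.sum_apply, LinearMap.smul_apply, LinearMap.comp_apply] at h
  rw [LinearMap.flip_apply, Representation.right_ιMulti]
  simp only [ρ.actLast_apply, h, sub_self, LinearMap.zero_apply]

theorem Representation.right_left_add_right (ρ : Representation A V) (X Y : Fund d K g)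
    (α : g →ₗ[K] V) : ρ.right Y (ρ.left X α + ρ.right X α) = 0 := by
  refine eq_of_ιMulti (ρ.right Y ∘ₗ (ρ.left.flip α + ρ.right.flip α)) 0 (fun x => ?_) X
  simp only [LinearMap.comp_apply, LinearMap.add_apply, LinearMap.flip_apply, ρ.left_add_right,
    map_neg, map_sum, map_smul, ρ.right_actLast, smul_zero, Finset.sum_const_zero, neg_zero,
    LinearMap.zero_apply]

theorem Representation.isLeibnizBimodule (ρ : Representation A V) :
    IsLeibnizBimodule A.circ ρ.left ρ.right :=
  ⟨A.circ_circ, ρ.left_circ, ρ.left_right, ρ.right_left_add_right⟩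

theorem isLeibnizBimodule_homAct (ρ : Representation A V) (ρ' : Representation A W) :
    IsLeibnizBimodule A.circ (homAct ρ ρ') (-homAct ρ ρ') := by
  have h : ∀ (X Y : Fund d K g) (α : V →ₗ[K] W), homAct ρ ρ' (A.circ X Y) α =
      homAct ρ ρ' X (homAct ρ ρ' Y α) - homAct ρ ρ' Y (homAct ρ ρ' X α) := by
    intro X Y α
    ext z
    simp only [LinearMap.sub_apply, homAct_apply, Representation.fund_circ,
      LinearMap.comp_apply, map_sub]
    abel
  refine ⟨A.circ_circ, h, fun X Y α => ?_, fun X Y α => ?_⟩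
  · simp only [LinearMap.neg_apply, h, map_neg]
    abel
  · simp

/-! ### Skew-symmetry in the last arguments -/

/-- The cochains that are skew-symmetric in their last `n` arguments from `g`; there is no condition
in degree `0`. -/
def IsSkew : ∀ {p : ℕ}, LeibnizCochain K (Fund d K g) (g →ₗ[K] W) p → Prop
  | 0, _ => True
  | p + 1, ω => ∀ (X : Fin p → Fund d K g) (x : Fin (d + 1) → g) (i : Fin (d + 1)),
      ω (Fin.snoc X (exteriorPower.ιMulti K (d + 1) x)) (x i) = 0

theorem isSkew_one_iff {ω : LeibnizCochain K (Fund d K g) (g →ₗ[K] W) 1} :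
    IsSkew ω ↔ ∀ (x : Fin (d + 1) → g) (i : Fin (d + 1)),
      ω (fun _ => exteriorPower.ιMulti K (d + 1) x) (x i) = 0 := by
  have e : ∀ (X : Fin 0 → Fund d K g) (Y : Fund d K g),
      (Fin.snoc X Y : Fin 1 → Fund d K g) = fun _ => Y := fun X Y => by
    funext j
    rw [Subsingleton.elim (α := Fin 1) j (Fin.last 0), Fin.snoc_last]
  simp only [IsSkew, e]
  exact ⟨fun h => h Fin.elim0, fun h _ => h⟩

theorem isSkew_iff_contract {p : ℕ}
    {ω : LeibnizCochain K (Fund d K g) (g →ₗ[K] W) (p + 2)} :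
    IsSkew ω ↔ ∀ X, IsSkew (contract X (p + 1) ω) := by
  simp only [IsSkew, contract_apply, Fin.cons_snoc_eq_snoc_cons]
  refine ⟨fun h X Y => h _, fun h X => ?_⟩
  have := h (X 0) (Fin.tail X)
  rwa [Fin.cons_self_tail] at this

theorem IsSkew.sub {p : ℕ} {ω η : LeibnizCochain K (Fund d K g) (g →ₗ[K] W) p}
    (h : IsSkew ω) (h' : IsSkew η) : IsSkew (ω - η) := by
  cases p with
  | zero => trivial
  | succ p =>
    intro X x i
    rw [sub_apply, LinearMap.sub_apply, h, h', sub_zero]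

theorem IsSkew.lieAct (ρ : Representation A W) {p : ℕ}
    {ω : LeibnizCochain K (Fund d K g) (g →ₗ[K] W) p} (h : IsSkew ω) (X : Fund d K g) :
    IsSkew (lieAct A.circ ρ.left X p ω) := by
  induction p with
  | zero => trivial
  | succ p ih =>
    cases p with
    | zero =>
      obtain ⟨F, rfl⟩ := (MultilinearMap.ofSubsingleton K (Fund d K g) (g →ₗ[K] W)
        (0 : Fin 1)).surjective ω
      rw [isSkew_one_iff] at h ⊢
      intro x i
      have hF : ∀ (x : Fin (d + 1) → g) (i : Fin (d + 1)),
          F (exteriorPower.ιMulti K (d + 1) x) (x i) = 0 := h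
      -- Polarization: exchanging the last argument with the `i`-th one changes the sign.
      have hG : ∀ u v : g,
          F (exteriorPower.ιMulti K (d + 1) (Function.update x i u)) v +
            F (exteriorPower.ιMulti K (d + 1) (Function.update x i v)) u = 0 := by
        intro u v
        have hs : ∀ u, F (exteriorPower.ιMulti K (d + 1) (Function.update x i u)) u = 0 :=
          fun u => by simpa only [Function.update_self] using hF (Function.update x i u) i
        have := hs (u + v)
        rw [AlternatingMap.map_update_add, map_add F, LinearMap.add_apply, map_add, map_add, hs,
          hs, zero_add, add_zero] at this
        exact this
      have hj : ∀ j, j ≠ i → F (exteriorPower.ιMulti K (d + 1)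
          (Function.update x j (A.ad X (x j)))) (x i) = 0 := fun j hj => by
        simpa only [Function.update_of_ne hj.symm] using hF (Function.update x j (A.ad X (x j))) i
      have h2 := hG (A.ad X (x i)) (x i)
      rw [Function.update_eq_self] at h2
      have h3 : F (A.circ X (exteriorPower.ιMulti K (d + 1) x)) (x i) =
          F (exteriorPower.ιMulti K (d + 1) (Function.update x i (A.ad X (x i)))) (x i) := by
        rw [NLieAlgebra.circ, LinearMap.comp_apply, derivation_ιMulti, map_sum,
          LinearMap.sum_apply, Finset.sum_eq_single i (fun j _ => hj j) (by simp)]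
      rw [lieAct_apply]
      simp only [MultilinearMap.ofSubsingleton_apply_apply, Fin.sum_univ_succ, Fin.sum_univ_zero,
        add_zero, Function.update_self, LinearMap.sub_apply, Representation.left_apply, hF,
        map_zero]
      rw [h3]
      rw [zero_sub, ← neg_add', add_comm, h2, neg_zero]
    | succ p =>
      rw [isSkew_iff_contract]
      intro Y
      rw [contract_lieAct]
      exact (ih (isSkew_iff_contract.mp h Y)).sub (isSkew_iff_contract.mp h _)

theorem IsSkew.delta (ρ : Representation A W) {p : ℕ}
    {ω : LeibnizCochain K (Fund d K g) (g →ₗ[K] W) p} (h : IsSkew ω) :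
    IsSkew (ρ.delta p ω) := by
  induction p with
  | zero =>
    rw [isSkew_one_iff]
    intro x i
    have e : ∀ α : g →ₗ[K] W, A.bracket (Fin.snoc x (x i)) = 0 ∧
        pairing (d + 1) ρ.act α (Fin.snoc x (x i)) = 0 := fun α =>
      ⟨A.bracket.map_eq_zero_of_eq _ (i := i.castSucc) (j := Fin.last (d + 1)) (by simp)
        (Fin.castSucc_lt_last i).ne,
      (pairing (d + 1) ρ.act α).map_eq_zero_of_eq _ (i := i.castSucc) (j := Fin.last (d + 1))
        (by simp) (Fin.castSucc_lt_last i).ne⟩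
    rw [Representation.delta, leibnizCoboundary_zero_apply, LinearMap.neg_apply,
      Representation.right_eq, LinearMap.sub_apply, LinearMap.comp_apply, A.ad_ιMulti,
      ρ.pair_ιMulti, (e _).2, (e 0).1, map_zero, sub_zero, neg_zero]
  | succ p ih =>
    rw [isSkew_iff_contract]
    intro X
    rw [Representation.delta, contract_leibnizCoboundary]
    refine (h.lieAct ρ X).sub ?_
    cases p with
    | zero => exact ih trivial
    | succ p => exact ih (isSkew_iff_contract.mp h X)

end Fundamental

/-! ### The differential of the complex -/

section Complex

variable {d : ℕ} {K M g V W : Type*} [Field K] [AddCommGroup M] [Module K M]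
  [AddCommGroup g] [Module K g] [AddCommGroup V] [Module K V] [AddCommGroup W] [Module K W]
  {A : NLieLM d K M g}

namespace LMRepresentation

variable (R : LMRepresentation A V W)

theorem rho₃Act_apply (Y : Fund d K g) (α : g →ₗ[K] W) :
    R.rho₃Act Y α = -exteriorPower.alternatingMapLinearEquiv
      (pairing d ((LinearMap.lflip (R₀ := K)).compAlternatingMap R.rho₃) α) Y := rfl

/-- `rho₃Act` is equivariant for the left actions. This is the compatibility of `ρ₁` with `ρ₃`. -/
theorem homAct_rho₃Act (X Y : Fund d K g) (α : g →ₗ[K] W) :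
    homAct A.rep R.rho₁ X (R.rho₃Act Y α) =
      R.rho₃Act Y (R.rho₂.left X α) + R.rho₃Act (A.alg.circ X Y) α := by
  refine eq_of_ιMulti ((homAct A.rep R.rho₁).flip (R.rho₃Act Y α))
    (R.rho₃Act Y ∘ₗ R.rho₂.left.flip α + R.rho₃Act.flip α ∘ₗ A.alg.circ.flip Y) (fun x => ?_) X
  set X := exteriorPower.ιMulti K (d + 1) x with hX
  refine eq_of_ιMulti (homAct A.rep R.rho₁ X ∘ₗ R.rho₃Act.flip α)
    (R.rho₃Act.flip (R.rho₂.left X α) + R.rho₃Act.flip α ∘ₗ A.alg.circ X) (fun y => ?_) Y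
  have h := pairing_equivariant ((LinearMap.lflip (R₀ := K)).compAlternatingMap R.rho₃)
    (A.alg.ad X) (R.rho₂.fund X) (homAct A.rep R.rho₁ X) (fun z w => by
      have e : ∀ u w m, (LinearMap.lflip (R₀ := K)).compAlternatingMap R.rho₃ u w m =
        R.rho₃ u m w := fun _ _ _ => rfl
      ext m
      simp only [homAct_apply, e, LinearMap.add_apply, LinearMap.sum_apply, hX, A.alg.ad_ιMulti,
        Representation.fund_ιMulti, R.rho₁_rho₃]
      abel) α y
  simp only [LinearMap.comp_apply, LinearMap.add_apply, LinearMap.flip_apply, rho₃Act_apply,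
    NLieAlgebra.circ, derivation_ιMulti, map_sum, map_neg,
    exteriorPower.alternatingMapLinearEquiv_apply_ιMulti, h, neg_add,
    Finset.sum_neg_distrib]
  rfl

/-- This is the formula for `ρ₃(u₁, …, uₙ₋₂, ρ(Y) m)`. -/
theorem rho₃Act_actLast (Y : Fund d K g) (u : Fin d → g) (w : W) :
    R.rho₃Act Y (R.rho₂.actLast u w) = -homAct A.rep R.rho₁ Y ((R.rho₃ u).flip w) := by
  refine eq_of_ιMulti (R.rho₃Act.flip (R.rho₂.actLast u w))
    (-(homAct A.rep R.rho₁).flip ((R.rho₃ u).flip w)) (fun y => ?_) Y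
  ext m
  simp only [LinearMap.flip_apply, LinearMap.neg_apply, homAct_apply, rho₃Act_ιMulti,
    Representation.fund_ιMulti, Representation.actLast_apply, R.rho₃_rep]
  abel

/-- The second condition on `rho₃Act` for the commutation of `h₁` with the coboundaries: the values
of `[X, ·]_L + [·, X]_R` are combinations of maps to which `rho₃Act_actLast` applies. -/
theorem rho₃Act_left_add_right (X Y : Fund d K g) (α : g →ₗ[K] W) :
    R.rho₃Act Y (R.rho₂.left X α + R.rho₂.right X α) =
      -(-homAct A.rep R.rho₁) Y (R.rho₃Act X α) := by
  refine eq_of_ιMulti (R.rho₃Act Y ∘ₗ (R.rho₂.left.flip α + R.rho₂.right.flip α))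
    (homAct A.rep R.rho₁ Y ∘ₗ R.rho₃Act.flip α) (fun x => ?_) X |>.trans (by simp)
  have h : R.rho₃Act (exteriorPower.ιMulti K (d + 1) x) α = ∑ i : Fin (d + 1),
      (-1 : K) ^ (d + 1 + (i : ℕ)) • (R.rho₃ (i.removeNth x)).flip (α (x i)) := by
    ext m
    simp only [rho₃Act_ιMulti, LinearMap.sum_apply, LinearMap.smul_apply, LinearMap.flip_apply]
  simp only [LinearMap.comp_apply, LinearMap.add_apply, LinearMap.flip_apply,
    Representation.left_add_right, map_neg, map_sum, map_smul, rho₃Act_actLast, h, smul_neg,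
    Finset.sum_neg_distrib, neg_neg]

/-- Precomposition with `f` fails to intertwine the right actions by exactly `φ ∘ rho₃Act`. -/
theorem right_comp_f (X : Fund d K g) (α : g →ₗ[K] W) :
    R.rho₂.right X α ∘ₗ A.f + homAct A.rep R.rho₂ X (α ∘ₗ A.f) =
      -(R.φ ∘ₗ R.rho₃Act X α) := by
  refine eq_of_ιMulti
    (LinearMap.lcomp K W A.f ∘ₗ R.rho₂.right.flip α + (homAct A.rep R.rho₂).flip (α ∘ₗ A.f))
    (-(LinearMap.llcomp K M V W R.φ ∘ₗ R.rho₃Act.flip α)) (fun x => ?_) X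
  ext m
  have h := LinearMap.congr_fun (R.rho₂.left_add_right x α) (A.f m)
  simp only [LinearMap.comp_apply, LinearMap.add_apply, LinearMap.flip_apply,
    LinearMap.neg_apply, LinearMap.sum_apply, LinearMap.smul_apply, Representation.left_apply,
    Representation.actLast_apply, homAct_apply, LinearMap.lcomp_apply, LinearMap.llcomp_apply,
    A.alg.ad_ιMulti, Representation.fund_ιMulti, A.equivariant, rho₃Act_ιMulti, map_sum, map_smul,
    R.φ_rho₃] at h ⊢
  rw [← h]
  abel

theorem left_comp_f (X : Fund d K g) (α : g →ₗ[K] W) :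
    LinearMap.lcomp K W A.f (R.rho₂.left X α) =
      homAct A.rep R.rho₂ X (LinearMap.lcomp K W A.f α) := by
  refine eq_of_ιMulti (LinearMap.lcomp K W A.f ∘ₗ R.rho₂.left.flip α)
    ((homAct A.rep R.rho₂).flip (LinearMap.lcomp K W A.f α)) (fun x => ?_) X
  ext m
  simp only [LinearMap.comp_apply, LinearMap.flip_apply, Representation.left_apply,
    homAct_apply, LinearMap.lcomp_apply, A.alg.ad_ιMulti, Representation.fund_ιMulti,
    A.equivariant]

theorem φ_homAct (X : Fund d K g) (ν : M →ₗ[K] V) :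
    R.φ ∘ₗ homAct A.rep R.rho₁ X ν = homAct A.rep R.rho₂ X (R.φ ∘ₗ ν) := by
  refine eq_of_ιMulti (LinearMap.llcomp K M V W R.φ ∘ₗ (homAct A.rep R.rho₁).flip ν)
    ((homAct A.rep R.rho₂).flip (R.φ ∘ₗ ν)) (fun x => ?_) X
  ext m
  simp only [LinearMap.comp_apply, LinearMap.flip_apply, homAct_apply, LinearMap.llcomp_apply,
    Representation.fund_ιMulti, map_sub, R.φ_equivariant]

theorem h₁_delta₁ (k : ℕ) (ω : LeibnizCochain K (Fund d K g) (g →ₗ[K] W) k) :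
    R.h₁ (k + 1) (R.delta₁ k ω) = R.delta₂ (k + 1) (R.h₁ k ω) := by
  have h := leibnizCoboundary_insertAct_last R.homAct_rho₃Act R.rho₃Act_left_add_right k ω
  simp only [h₁, delta₁, delta₂, deltaHom, Representation.delta, LinearMap.neg_apply, map_neg, h]

/-- `h₂` is not a map of complexes: by `right_comp_f` its defect is `φ♯ h₁`. -/
theorem h₂_delta₁ (k : ℕ) (ω : LeibnizCochain K (Fund d K g) (g →ₗ[K] W) k) :
    R.h₂ (k + 1) (R.delta₁ k ω) + R.delta₃ (k + 1) (R.h₂ k ω) = R.φSharp (k + 1) (R.h₁ k ω) := by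
  change (-1 : K) ^ (k + 1) • mapCoeff (LinearMap.lcomp K W A.f) (k + 1)
      (leibnizCoboundary A.alg.circ R.rho₂.left R.rho₂.right k ω) +
    leibnizCoboundary A.alg.circ (homAct A.rep R.rho₂) (-homAct A.rep R.rho₂) k
      ((-1 : K) ^ k • mapCoeff (LinearMap.lcomp K W A.f) k ω) =
    mapCoeff (LinearMap.llcomp K M V W R.φ) (k + 1) (-insertAct R.rho₃Act (Fin.last k) ω)
  ext1 X
  -- The terms with a left action cancel; the last argument `X (Fin.last k)` contributes `h`.
  have h := R.right_comp_f (X (Fin.last k)) (ω (Fin.init X))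
  have e : (-1 : K) ^ (k + 1) * (-1 : K) ^ (k + 1) = 1 := by
    rw [← mul_pow, neg_one_mul, neg_neg, one_pow]
  rw [add_apply, smul_apply, mapCoeff_leibnizCoboundary (LinearMap.lcomp K W A.f) R.left_comp_f
    (r' := -homAct A.rep R.rho₂), map_smul, smul_apply, smul_add, smul_smul, e, one_smul,
    mapCoeff_apply, LinearMap.neg_apply, LinearMap.neg_apply, sub_neg_eq_add, neg_apply,
    insertAct_apply, map_neg, Fin.removeNth_last, pow_succ, mul_neg_one, neg_smul, add_right_comm,
    neg_add_cancel, zero_add]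
  exact h

theorem φSharp_delta₂ (k : ℕ) (ν : LeibnizCochain K (Fund d K g) (M →ₗ[K] V) k) :
    R.φSharp (k + 1) (R.delta₂ k ν) = R.delta₃ (k + 1) (R.φSharp k ν) := by
  change mapCoeff (LinearMap.llcomp K M V W R.φ) (k + 1)
      (leibnizCoboundary A.alg.circ (homAct A.rep R.rho₁) (-homAct A.rep R.rho₁) k ν) =
    leibnizCoboundary A.alg.circ (homAct A.rep R.rho₂) (-homAct A.rep R.rho₂) k
      (mapCoeff (LinearMap.llcomp K M V W R.φ) k ν)
  ext1 X
  have h : ∀ X ν, LinearMap.llcomp K M V W R.φ (homAct A.rep R.rho₁ X ν) =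
    homAct A.rep R.rho₂ X (LinearMap.llcomp K M V W R.φ ν) := R.φ_homAct
  rw [mapCoeff_leibnizCoboundary (LinearMap.llcomp K M V W R.φ) h (r' := -homAct A.rep R.rho₂)]
  simp only [LinearMap.neg_apply, map_neg, h, sub_self, smul_zero, add_zero]

theorem delta₃_delta₃ (k : ℕ) (θ : ThirdCochain d K M g W k) :
    R.delta₃ (k + 1) (R.delta₃ k θ) = 0 := by
  cases k with
  | zero => exact map_zero _
  | succ k => exact (isLeibnizBimodule_homAct A.rep R.rho₂).leibnizCoboundary_leibnizCoboundary k θ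

theorem D_comp_D (k : ℕ) : R.D (k + 1) ∘ₗ R.D k = 0 := by
  refine LinearMap.ext fun c => Cochain.ext ?_ ?_ ?_
  · change -R.delta₁ (k + 1) (-R.delta₁ k c.1) = 0
    rw [map_neg, neg_neg]
    exact R.rho₂.isLeibnizBimodule.leibnizCoboundary_leibnizCoboundary k c.1
  · change -R.h₁ (k + 1) (-R.delta₁ k c.1) +
      R.delta₂ (k + 1) (-R.h₁ k c.1 + R.delta₂ k c.2.1) = 0
    have h : R.delta₂ (k + 1) (R.delta₂ k c.2.1) = 0 :=
      (isLeibnizBimodule_homAct A.rep R.rho₁).leibnizCoboundary_leibnizCoboundary k c.2.1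
    rw [map_neg, map_add, map_neg, h, h₁_delta₁]
    abel
  · change -R.h₂ (k + 1) (-R.delta₁ k c.1) + R.φSharp (k + 1) (-R.h₁ k c.1 + R.delta₂ k c.2.1) -
      R.delta₃ (k + 1) (-R.h₂ k c.1 + R.φSharp k c.2.1 - R.delta₃ k c.2.2) = 0
    rw [map_neg, map_add, map_neg, map_sub, map_add, map_neg, delta₃_delta₃, φSharp_delta₂,
      ← h₂_delta₁]
    abel

theorem coboundaries_le_cocycles (k : ℕ) : R.coboundaries k ≤ R.cocycles k := by
  cases k with
  | zero => exact bot_le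
  | succ k => exact LinearMap.range_le_ker_iff.mpr (R.D_comp_D k)

end LMRepresentation

theorem mem_skewCochains_iff {k : ℕ} (c : Cochain d K M g V W k) :
    c ∈ skewCochains d K M g V W k ↔ IsSkew c.1 := by
  cases k <;> rfl

theorem map_D_skewCochains_le (R : LMRepresentation A V W) (k : ℕ) :
    (skewCochains d K M g V W k).map (R.D k) ≤ skewCochains d K M g V W (k + 1) := by
  rintro _ ⟨c, hc, rfl⟩
  rw [SetLike.mem_coe, mem_skewCochains_iff] at hc
  intro X x i
  change (-R.rho₂.delta k c.1) _ _ = 0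
  rw [neg_apply, LinearMap.neg_apply, neg_eq_zero]
  exact hc.delta R.rho₂ X x i

end Complex

/-! ### Totally skew-symmetric cochains of Lie algebras -/

section Lie

variable {K M g V W : Type*} [Field K] [AddCommGroup M] [Module K M]
  [AddCommGroup g] [Module K g] [AddCommGroup V] [Module K V] [AddCommGroup W] [Module K W]

/-- For `n = 2` every fundamental object is a vector of `g`. -/
theorem exists_ιMulti_one_eq (X : Fund 0 K g) :
    ∃ z : g, exteriorPower.ιMulti K (0 + 1) (fun _ => z) = X :=
  ⟨exteriorPower.oneEquiv K g X, (exteriorPower.oneEquiv_symm_apply K g _).symm.trans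
    ((exteriorPower.oneEquiv K g).symm_apply_apply X)⟩

theorem mem_altLeibniz_zero_iff {E : Type*} [AddCommGroup E] [Module K E] {p : ℕ}
    {ω : LeibnizCochain K (Fund 0 K g) E p} : ω ∈ altLeibniz 0 K g E p ↔ IsAlt ω := by
  constructor
  · intro h X s t hst hX
    choose z hz using fun Y : Fund 0 K g => exists_ιMulti_one_eq Y
    have := h (fun a _ => z (X a)) (s, 0) (t, 0) (by simpa using hst) (by simp [hX])
    simpa only [hz] using this
  · intro h x s t hst hx
    have h1 : ∀ i : Fin (0 + 1), i = 0 := fun i => Subsingleton.elim (α := Fin 1) i 0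
    refine h _ s.1 t.1 (fun e => hst (Prod.ext e (by rw [h1 s.2, h1 t.2]))) ?_
    congr 1
    funext i
    rw [h1 i, ← h1 s.2, hx, h1 t.2, h1 s.2]

theorem circ_self (A : NLieAlgebra 0 K g) (X : Fund 0 K g) : A.circ X X = 0 := by
  obtain ⟨z, rfl⟩ := exists_ιMulti_one_eq X
  rw [A.circ_ιMulti]
  refine Finset.sum_eq_zero fun i _ => ?_
  rw [A.bracket.map_eq_zero_of_eq (Fin.snoc (fun _ => z) z) (i := 0) (j := 1) rfl (by simp)]
  exact (exteriorPower.ιMulti K (0 + 1)).map_coord_zero i (Function.update_self _ _ _)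

/-- A cochain of a Lie algebra that is alternating and skew-symmetric in its last two arguments is
totally skew-symmetric. -/
theorem IsSkew.apply_eq_zero {p : ℕ} {ω : LeibnizCochain K (Fund 0 K g) (g →ₗ[K] W) p}
    (hs : IsSkew ω) (ha : IsAlt ω) (X : Fin p → Fund 0 K g) (s : Fin p) (x : Fin (0 + 1) → g)
    (hx : X s = exteriorPower.ιMulti K (0 + 1) x) (i : Fin (0 + 1)) : ω X (x i) = 0 := by
  cases p with
  | zero => exact s.elim0
  | succ p =>
    have hlast : ∀ Y : Fin (p + 1) → Fund 0 K g,
        Y (Fin.last p) = exteriorPower.ιMulti K (0 + 1) x → ω Y (x i) = 0 := by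
      intro Y hY
      rw [← Fin.snoc_init_self Y, hY]
      exact hs _ x i
    rcases eq_or_ne s (Fin.last p) with rfl | h
    · exact hlast X hx
    · have h1 := hlast (X ∘ Equiv.swap s (Fin.last p)) (by simpa using hx)
      rwa [ha.map_swap X h, LinearMap.neg_apply, neg_eq_zero] at h1

theorem isSkew_of_apply_eq_zero {p : ℕ} {ω : LeibnizCochain K (Fund 0 K g) (g →ₗ[K] W) p}
    (h : ∀ (x : Fin p → Fin (0 + 1) → g) (s : Fin p × Fin (0 + 1)),
      ω (fun a => exteriorPower.ιMulti K (0 + 1) (x a)) (x s.1 s.2) = 0) : IsSkew ω := by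
  cases p with
  | zero => trivial
  | succ p =>
    intro X x i
    choose z hz using fun Y : Fund 0 K g => exists_ιMulti_one_eq Y
    have h1 := h (Fin.snoc (fun a _ => z (X a)) x) (Fin.last p, i)
    rw [Fin.snoc_last] at h1
    convert h1 using 3
    funext a
    refine Fin.lastCases ?_ (fun a => ?_) a
    · simp only [Fin.snoc_last]
    · simp only [Fin.snoc_castSucc, hz]

theorem IsAlt.insertAct_last {L E F : Type*} [AddCommGroup L] [Module K L] [AddCommGroup E]
    [Module K E] [AddCommGroup F] [Module K F] {a : L →ₗ[K] (E →ₗ[K] F)} {p : ℕ}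
    {ω : LeibnizCochain K L E p} (h : IsAlt ω) (ha : ∀ X s, a (X s) (ω X) = 0) :
    IsAlt (insertAct a (Fin.last p) ω) := by
  intro X s t hst hX
  rw [insertAct_apply, Fin.removeNth_last]
  induction s using Fin.lastCases with
  | last =>
    induction t using Fin.lastCases with
    | last => exact absurd rfl hst
    | cast t => rw [hX]; exact ha (Fin.init X) t
  | cast s =>
    induction t using Fin.lastCases with
    | last => rw [← hX]; exact ha (Fin.init X) s
    | cast t =>
      rw [h (Fin.init X) s t (fun e => hst (congrArg _ e)) hX, map_zero]

theorem IsAlt.mapCoeff {L E F : Type*} [AddCommGroup L] [Module K L] [AddCommGroup E]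
    [Module K E] [AddCommGroup F] [Module K F] (T : E →ₗ[K] F) {p : ℕ}
    {ω : LeibnizCochain K L E p} (h : IsAlt ω) : IsAlt (mapCoeff T p ω) := by
  intro X s t hst hX
  rw [mapCoeff_apply, h X s t hst hX, map_zero]

theorem IsAlt.delta {A : NLieAlgebra 0 K g} (ρ : Representation A W) {p : ℕ}
    {ω : LeibnizCochain K (Fund 0 K g) (g →ₗ[K] W) p} (h : IsAlt ω) (hs : IsSkew ω) :
    IsAlt (ρ.delta p ω) := by
  refine h.leibnizCoboundary (circ_self A) fun X s => ?_
  obtain ⟨z, hz⟩ := exists_ιMulti_one_eq (X s)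
  have h0 := fun i => hs.apply_eq_zero h X s (fun _ => z) hz.symm i
  rw [← hz, ρ.left_add_right, neg_eq_zero]
  refine Finset.sum_eq_zero fun i _ => ?_
  rw [h0 i]
  ext
  simp [Representation.actLast]

theorem IsAlt.deltaHom {A : NLieAlgebra 0 K g} (ρ : Representation A V)
    (ρ' : Representation A W) {p : ℕ} {ω : LeibnizCochain K (Fund 0 K g) (V →ₗ[K] W) p}
    (h : IsAlt ω) : IsAlt (deltaHom ρ ρ' p ω) :=
  h.leibnizCoboundary (circ_self A) fun X s => by
    rw [LinearMap.neg_apply, LinearMap.neg_apply, add_neg_cancel]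

/-- For `n = 2` the cochain `h₁ω` is, up to sign, `ρ₃(m) ω(X₁, …, Xₖ₊₁)`. -/
theorem IsAlt.h₁ {A : NLieLM 0 K M g} (R : LMRepresentation A V W) {p : ℕ}
    {ω : LeibnizCochain K (Fund 0 K g) (g →ₗ[K] W) p} (h : IsAlt ω) (hs : IsSkew ω) :
    IsAlt (insertAct R.rho₃Act (Fin.last p) ω) := by
  refine h.insertAct_last fun X s => ?_
  obtain ⟨z, hz⟩ := exists_ιMulti_one_eq (X s)
  have h0 := fun i => hs.apply_eq_zero h X s (fun _ => z) hz.symm i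
  ext m
  rw [← hz, R.rho₃Act_ιMulti, LinearMap.zero_apply]
  refine Finset.sum_eq_zero fun i _ => ?_
  rw [h0 i, map_zero, smul_zero]

theorem map_D_altCochains_le {A : NLieLM 0 K M g} (R : LMRepresentation A V W) (k : ℕ) :
    (altCochains 0 K M g V W k).map (R.D k) ≤ altCochains 0 K M g V W (k + 1) := by
  rintro _ ⟨c, ⟨hω, hv, hν, hθ⟩, rfl⟩
  have hs := isSkew_of_apply_eq_zero hv
  have ha := mem_altLeibniz_zero_iff.mp hω
  have hn := mem_altLeibniz_zero_iff.mp hν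
  refine ⟨?_, ?_, ?_, ?_⟩
  · exact neg_mem (mem_altLeibniz_zero_iff.mpr (ha.delta R.rho₂ hs))
  · intro x s
    change (-R.rho₂.delta k c.1) _ _ = 0
    rw [neg_apply, LinearMap.neg_apply, neg_eq_zero]
    exact (hs.delta R.rho₂).apply_eq_zero (ha.delta R.rho₂ hs) _ s.1 (x s.1) rfl s.2
  · exact add_mem (neg_mem (neg_mem (mem_altLeibniz_zero_iff.mpr (ha.h₁ R hs))))
      (mem_altLeibniz_zero_iff.mpr (hn.deltaHom A.rep R.rho₁))
  · change -R.h₂ k c.1 + R.φSharp k c.2.1 - R.delta₃ k c.2.2 ∈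
      altLeibniz 0 K g (M →ₗ[K] W) k
    refine sub_mem (add_mem (neg_mem ?_) ?_) ?_
    · exact Submodule.smul_mem _ _ (mem_altLeibniz_zero_iff.mpr (ha.mapCoeff _))
    · exact mem_altLeibniz_zero_iff.mpr (hn.mapCoeff _)
    · cases k with
      | zero => exact zero_mem _
      | succ k =>
        exact mem_altLeibniz_zero_iff.mpr
          ((mem_altLeibniz_zero_iff.mp hθ).deltaHom A.rep R.rho₂)

end Lie

end NLie

end

theorem mainTheorem3 {d : ℕ} {K M g V W : Type*} [Field K]
    [AddCommGroup M] [Module K M] [AddCommGroup g] [Module K g]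
    [AddCommGroup V] [Module K V] [AddCommGroup W] [Module K W]
    (A : NLie.NLieLM d K M g) (R : NLie.LMRepresentation A V W) :
    (∀ k : ℕ, R.D (k + 1) ∘ₗ R.D k = 0) ∧
    (∀ k : ℕ, R.coboundaries k ≤ R.cocycles k) ∧
    (∀ k : ℕ, (NLie.skewCochains d K M g V W k).map (R.D k) ≤
      NLie.skewCochains d K M g V W (k + 1)) ∧
    (d = 0 → ∀ k : ℕ, (NLie.altCochains d K M g V W k).map (R.D k) ≤
      NLie.altCochains d K M g V W (k + 1)) := by
  refine ⟨R.D_comp_D, R.coboundaries_le_cocycles, NLie.map_D_skewCochains_le R, ?_⟩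
  rintro rfl
  exact NLie.map_D_altCochains_le R
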